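/- Let $\mathfrak X$ be a countably infinite alphabet, $\mathfrak X^*$ the free monoid of words over $\mathfrak X$, and let $x$, $y_i,z_i,t_i$ $(i\ge 1)$ be distinct letters of $\mathfrak X$. A letter is simple [multiple] in a word $\mathbf w$ if it occurs in $\mathbf w$ exactly once [at least twice]; the blocks of $\mathbf w$ are the maximal factors of $\mathbf w$ containing no letter that is simple in $\mathbf w$. Define relations on $\mathfrak X^*$: $\mathbf u\mathrel{\gamma}\mathbf v$ iff $\mathbf u$ and $\mathbf v$ have the same simple letters and $\mathbf u$ is obtained from $\mathbf v$ by changing the individual (positive) exponents of letters; $\mathbf u\mathrel{\beta}\mathbf v$ iff $\mathbf u\mathrel{\gamma}\mathbf v$ and, for each multiple letter, its first two occurrences lie in the same block of $\mathbf u$ if and only if they lie in the same block of $\mathbf v$. The relation $\beta$ is a congruence on $\mathfrak X^*$; write $[\mathbf w]^\beta$ for the $\beta$-class of $\mathbf w$. For a $\beta$-class $\mathtt u$, let $M_\beta(\mathtt u)$ be the Rees quotient of $\mathfrak X^*/\beta$ over the ideal of all $\beta$-classes $\mathtt v$ that are not factors of $\mathtt u$ (that is, $\mathtt u\neq\mathtt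 p\mathtt v\mathtt s$ for all $\mathtt p,\mathtt s\in\mathfrak X^*/\beta$), and let $\mathbf M_\beta(\mathtt u)$ be the variety of monoids generated by $M_\beta(\mathtt u)$. For $k\ge 1$ and a permutation $\pi$ of $\{1,\dots,k\}$ (with $i\pi$ the image of $i$) put $$\mathbf a_{0,k}[\pi]:=x\Bigl(\prod_{i=1}^{k-1}z_{i\pi}y_i^2\Bigr)z_{k\pi}\,x\Bigl(\prod_{i=1}^{k}t_iz_i\Bigr).$$ **Proposition.** For every $k\ge 2$ and every $\pi\in S_k$, the lattice of all subvarieties of $\mathbf M_\beta\bigl([\mathbf a_{0,k}[\pi]]^\beta\bigr)$ is not distributive. -/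

import Mathlib

universe u v

/-! ### Words -/

/-- The countably infinite alphabet: the letter `x` and the letters `y_i`, `z_i`, `t_i`. -/
inductive Letter : Type
  | x : Letter
  | y : ℕ → Letter
  | z : ℕ → Letter
  | t : ℕ → Letter
  deriving DecidableEq

instance Letter.instInfinite : Infinite Letter :=
  Infinite.of_injective Letter.y (fun _ _ h => by injection h)

instance Letter.instCountable : Countable Letter := by
  let f : Letter → ℕ × ℕ := fun l =>
    match l with
    | .x => (0, 0)
    | .y i => (1, i)
    | .z i => (2, i)
    | .t i => (3, i)
  have hf : Function.Injective f := by
    intro a b h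
    cases a <;> cases b <;> simp_all [f]
  exact hf.countable

/-- The free monoid over the alphabet. -/
abbrev Word : Type := FreeMonoid Letter

namespace Word

/-- The letter `a` is simple in `w`: it occurs exactly once. -/
def IsSimple (a : Letter) (w : Word) : Prop := w.toList.count a = 1

/-- The letter `a` is multiple in `w`: it occurs at least twice. -/
def IsMultiple (a : Letter) (w : Word) : Prop := 2 ≤ w.toList.count a

/-- The sequence of bases of the islands of `w`: every maximal power `a ^ e` of a letter (`1 ≤ e`)
is replaced by `a`. Two words have the same skeleton iff one is obtained from the other by changing
the (positive) individual exponents of letters. -/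
def skeleton (w : Word) : List Letter := w.toList.destutter (· ≠ ·)

/-- The first two occurrences of `a` exist and lie in the same block of `w`. The blocks of `w` are
the maximal factors of `w` that contain no letter that is simple in `w`, so this says
that `w = p a q a r` with these two occurrences of `a` the first ones, where no letter of `q` is
simple in `w`. -/
def FirstTwoInSameBlock (a : Letter) (w : Word) : Prop :=
  ∃ p q r : List Letter, w.toList = p ++ a :: (q ++ a :: r) ∧ a ∉ p ∧ a ∉ q ∧
    ∀ b ∈ q, ¬ IsSimple b w

/-- The relation `γ`. -/
def GammaRel (w₁ w₂ : Word) : Prop :=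
  (∀ a, IsSimple a w₁ ↔ IsSimple a w₂) ∧ skeleton w₁ = skeleton w₂

/-- The relation `β`. -/
def BetaRel (w₁ w₂ : Word) : Prop :=
  GammaRel w₁ w₂ ∧
    ∀ a, IsMultiple a w₁ → (FirstTwoInSameBlock a w₁ ↔ FirstTwoInSameBlock a w₂)

end Word

namespace Word

/-! ### `β` is a congruence -/

theorem destutter'_aux (l m : List Letter) (a c : Letter) :
    (a :: l ++ m).destutter' (· ≠ ·) c = (l.destutter' (· ≠ ·) a ++ m).destutter' (· ≠ ·) c := by
  induction l generalizing a c with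
  | nil => rfl
  | cons b l ih =>
    by_cases hab : a = b
    · subst hab
      rw [List.destutter'_cons_neg (a := a) (b := a) l (by simp), ← ih]
      by_cases hca : c = a
      · subst hca; simp
      · simp [hca]
    · rw [List.destutter'_cons_pos (b := a) l hab]
      have h1 := ih b a
      have h2 := ih b c
      simp only [List.cons_append] at h1 h2 ⊢
      by_cases hca : c = a
      · subst hca
        rw [List.destutter'_cons_neg (a := c) _ (by simp), h2,
          List.destutter'_cons_neg (a := c) _ (by simp)]
      · rw [List.destutter'_cons_pos (a := a) _ hca, List.destutter'_cons_pos (a := a) _ hca, h1]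

theorem destutter'_destutter (l : List Letter) (c : Letter) :
    l.destutter' (· ≠ ·) c = (l.destutter (· ≠ ·)).destutter' (· ≠ ·) c := by
  cases l with
  | nil => rfl
  | cons a l =>
    have := destutter'_aux l [] a c
    rwa [List.append_nil, List.append_nil] at this

theorem destutter'_append (l m : List Letter) (c : Letter) :
    (l ++ m).destutter' (· ≠ ·) c
      = (l.destutter (· ≠ ·) ++ m.destutter (· ≠ ·)).destutter' (· ≠ ·) c := by
  induction l generalizing c with
  | nil => simpa using destutter'_destutter m c
  | cons a l ih =>
    rw [List.destutter_cons', ← destutter'_aux]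
    simp only [List.cons_append]
    have key : ∀ d, (l ++ m).destutter' (· ≠ ·) d =
        (l ++ m.destutter (· ≠ ·)).destutter' (· ≠ ·) d := by
      intro d
      rw [ih d]
      cases l with
      | nil => simp
      | cons b l => rw [List.destutter_cons', ← destutter'_aux]
    by_cases hca : c = a
    · subst hca
      rw [List.destutter'_cons_neg _ (by simp), List.destutter'_cons_neg _ (by simp), key]
    · rw [List.destutter'_cons_pos _ hca, List.destutter'_cons_pos _ hca, key]

theorem destutter_append_congr {l l' m m' : List Letter}
    (h : l.destutter (· ≠ ·) = l'.destutter (· ≠ ·))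
    (h' : m.destutter (· ≠ ·) = m'.destutter (· ≠ ·)) :
    (l ++ m).destutter (· ≠ ·) = (l' ++ m').destutter (· ≠ ·) := by
  cases l with
  | nil =>
    have : l' = [] := by
      rw [← List.destutter_eq_nil (R := (· ≠ ·)), ← h]; rfl
    subst this
    simpa using h'
  | cons a l =>
    cases l' with
    | nil => exact absurd h (by simp [List.destutter_cons', List.destutter'_ne_nil])
    | cons b l' =>
      have hab : a = b := by
        have h1 : ∀ (k : List Letter) (d : Letter), (k.destutter' (· ≠ ·) d).head? = some d := by
          intro k
          induction k with
          | nil => intro d; rfl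
          | cons e k ih =>
            intro d
            rw [List.destutter'_cons]
            split_ifs
            · rfl
            · exact ih d
        have := congrArg List.head? h
        simpa [List.destutter_cons', h1] using this
      subst hab
      have e1 : ∀ k : List Letter, (a :: k).destutter (· ≠ ·)
          = (a :: k).destutter' (· ≠ ·) a := by
        intro k
        rw [List.destutter_cons', List.destutter'_cons_neg _ (by simp)]
      rw [List.cons_append, List.cons_append, e1, e1, ← List.cons_append, ← List.cons_append,
        destutter'_append, destutter'_append (a :: l'), h, h']

theorem sublist_destutter'_aux (w l : List Letter) (c : Letter)
    (hl : (c :: l).IsChain (· ≠ ·)) (h : l.Sublist w) :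
    (c :: l).Sublist (w.destutter' (· ≠ ·) c) := by
  induction w generalizing c l with
  | nil =>
    have := List.sublist_nil.mp h
    subst this
    simp
  | cons b w ih =>
    by_cases hcb : c = b
    · subst hcb
      rw [List.destutter'_cons_neg _ (by simp)]
      refine ih l c hl ?_
      cases l with
      | nil => simp
      | cons d l =>
        have hcd : c ≠ d := by
          rw [List.isChain_cons_cons] at hl; exact hl.1
        rcases List.sublist_cons_iff.mp h with h | ⟨r, hr, -⟩
        · exact h
        · exact absurd (List.cons.inj hr).1.symm hcd
    · rw [List.destutter'_cons_pos _ hcb]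
      refine List.Sublist.cons_cons c ?_
      have hl' : l.IsChain (· ≠ ·) := by
        cases l with
        | nil => simp
        | cons d l => rw [List.isChain_cons_cons] at hl; exact hl.2
      cases l with
      | nil => simp
      | cons d l =>
        by_cases hdb : d = b
        · subst hdb
          exact ih l d hl' (List.cons_sublist_cons.mp h)
        · have h2 : (d :: l).Sublist w := by
            rcases List.sublist_cons_iff.mp h with h | ⟨r, hr, -⟩
            · exact h
            · exact absurd (List.cons.inj hr).1 hdb
          exact (List.sublist_cons_self b _).trans
            (ih (d :: l) b (List.isChain_cons_cons.mpr ⟨fun h => hdb h.symm, hl'⟩) h2)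

theorem sublist_destutter {w l : List Letter} (hl : l.IsChain (· ≠ ·)) (h : l.Sublist w) :
    l.Sublist (w.destutter (· ≠ ·)) := by
  cases w with
  | nil => simpa using h
  | cons b w =>
    rw [List.destutter_cons', show w.destutter' (· ≠ ·) b = (b :: w).destutter' (· ≠ ·) b by
      rw [List.destutter'_cons_neg _ (by simp)]]
    cases l with
    | nil => simp
    | cons d l =>
      by_cases hdb : d = b
      · subst hdb
        rw [List.destutter'_cons_neg _ (by simp)]
        exact sublist_destutter'_aux w l d hl (List.cons_sublist_cons.mp h)
      · exact (List.sublist_cons_self b _).trans (sublist_destutter'_aux (b :: w) (d :: l) b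
          (List.isChain_cons_cons.mpr ⟨fun h => hdb h.symm, hl⟩) h)

theorem GammaRel.symm {u v : Word} (h : GammaRel u v) : GammaRel v u :=
  ⟨fun a => (h.1 a).symm, h.2.symm⟩

theorem GammaRel.trans {u v w : Word} (h : GammaRel u v) (h' : GammaRel v w) : GammaRel u w :=
  ⟨fun a => (h.1 a).trans (h'.1 a), h.2.trans h'.2⟩

theorem GammaRel.sublist {u v : Word} (h : GammaRel u v) {l : List Letter}
    (hl : l.IsChain (· ≠ ·)) (hs : l.Sublist u.toList) : l.Sublist v.toList := by
  have h1 := sublist_destutter hl hs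
  have h2 : u.toList.destutter (· ≠ ·) = v.toList.destutter (· ≠ ·) := h.2
  rw [h2] at h1
  exact h1.trans (List.destutter_sublist _ _)

theorem GammaRel.mem_iff {u v : Word} (h : GammaRel u v) (a : Letter) :
    a ∈ u.toList ↔ a ∈ v.toList := by
  rw [← List.singleton_sublist, ← List.singleton_sublist]
  exact ⟨h.sublist (by simp), h.symm.sublist (by simp)⟩

theorem GammaRel.count_cases {u v : Word} (h : GammaRel u v) (a : Letter) :
    (u.toList.count a = 0 ∧ v.toList.count a = 0) ∨ (u.toList.count a = 1 ∧ v.toList.count a = 1) ∨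
      (2 ≤ u.toList.count a ∧ 2 ≤ v.toList.count a) := by
  have h1 : u.toList.count a = 1 ↔ v.toList.count a = 1 := h.1 a
  have h2 := h.mem_iff a
  rw [← List.count_pos_iff, ← List.count_pos_iff] at h2
  omega

theorem GammaRel.mul {u v u' v' : Word} (h : GammaRel u v) (h' : GammaRel u' v') :
    GammaRel (u * u') (v * v') := by
  constructor
  · intro a
    have h1 := h.count_cases a
    have h2 := h'.count_cases a
    simp only [IsSimple, FreeMonoid.toList_mul, List.count_append]
    omega
  · simp only [skeleton, FreeMonoid.toList_mul]
    exact destutter_append_congr h.2 h'.2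

theorem sublist_two {a b : Letter} {l m : List Letter} (h : [a, b].Sublist (l ++ m)) :
    [a, b].Sublist l ∨ (a ∈ l ∧ b ∈ m) ∨ [a, b].Sublist m := by
  obtain ⟨r, s, e, hr, hs⟩ := List.sublist_append_iff.mp h
  match r, e with
  | [], e => right; right; simpa [e] using hs
  | [_], e =>
    simp at e
    obtain ⟨rfl, rfl⟩ := e
    right; left; exact ⟨List.singleton_sublist.mp hr, List.singleton_sublist.mp hs⟩
  | _ :: _ :: _, e =>
    simp at e
    obtain ⟨rfl, rfl, rfl, rfl⟩ := e
    left; exact hr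

theorem sublist_three {a b c : Letter} {l m : List Letter} (h : [a, b, c].Sublist (l ++ m)) :
    [a, b, c].Sublist l ∨ ([a, b].Sublist l ∧ c ∈ m) ∨ (a ∈ l ∧ [b, c].Sublist m) ∨
      [a, b, c].Sublist m := by
  obtain ⟨r, s, e, hr, hs⟩ := List.sublist_append_iff.mp h
  match r, e with
  | [], e => right; right; right; simpa [e] using hs
  | [_], e =>
    simp at e
    obtain ⟨rfl, rfl⟩ := e
    right; right; left; exact ⟨List.singleton_sublist.mp hr, hs⟩
  | [_, _], e =>
    simp at e
    obtain ⟨rfl, rfl, rfl⟩ := e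
    right; left; exact ⟨hr, List.singleton_sublist.mp hs⟩
  | _ :: _ :: _ :: _, e =>
    simp at e
    obtain ⟨rfl, rfl, rfl, rfl, rfl⟩ := e
    left; exact hr

theorem sublist_mid {a b t : Letter} {p s : List Letter} (hp : t ∉ p) (hs : t ∉ s)
    (hat : a ≠ t) (h : [a, t, b].Sublist (p ++ t :: s)) : a ∈ p ∧ [b].Sublist s := by
  have e2 : ∀ l : List Letter, [a, t].Sublist ([t] ++ l) → t ∈ l := fun l h => by
    rcases List.sublist_cons_iff.mp h with h | ⟨r, hr, -⟩
    · exact h.subset (by simp)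
    · exact absurd (List.cons.inj hr).1 hat
  rcases sublist_three h with h | ⟨h, -⟩ | ⟨h, h'⟩ | h
  · exact absurd (h.subset (by simp)) hp
  · exact absurd (h.subset (by simp)) hp
  · exact ⟨h, List.cons_sublist_cons.mp h'⟩
  · exact absurd (e2 s (List.Sublist.trans (by simp) h)) hs

/-- `t` is a simple letter of `w` lying between the first two occurrences of `a`. -/
def Sep (a t : Letter) (w : Word) : Prop :=
  IsSimple t w ∧ [a, t, a].Sublist w.toList ∧ ¬ [a, a, t].Sublist w.toList

theorem sublist_split {a t : Letter} {w : List Letter} (h : [a, t, a].Sublist w)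
    (ht : w.count t = 1) : ∃ p s, w = p ++ t :: s ∧ t ∉ p ∧ t ∉ s ∧ a ∈ p ∧ a ∈ s ∧ a ≠ t := by
  have hat : a ≠ t := by
    rintro rfl
    have := h.count_le a
    simp at this
    omega
  have htw : t ∈ w := List.count_pos_iff.mp (by omega)
  obtain ⟨p, s, rfl⟩ := List.append_of_mem htw
  rw [List.count_append, List.count_cons_self] at ht
  have hp : t ∉ p := List.count_eq_zero.mp (by omega)
  have hs : t ∉ s := List.count_eq_zero.mp (by omega)
  have h2 := sublist_mid hp hs hat h
  exact ⟨p, s, rfl, hp, hs, h2.1, List.singleton_sublist.mp h2.2, hat⟩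

theorem firstTwo_iff {a : Letter} {w : Word} (ha : IsMultiple a w) :
    FirstTwoInSameBlock a w ↔ ¬ ∃ t, Sep a t w := by
  unfold IsMultiple at ha
  constructor
  · rintro ⟨p, q, r, hw, hp, hq, hs⟩ ⟨t, h1, h2, h3⟩
    obtain ⟨p', s', hw', hp', hs', hap, has, hat⟩ := sublist_split h2 h1
    have htq : t ∉ q := fun h => hs t h h1
    have htw : t ∈ w.toList := by simp [hw']
    have h4 : [a, a, t].Sublist w.toList → False := h3
    have h5 := h2
    rw [hw] at h2 h4 htw
    have htr : t ∈ p ∨ t ∈ r := by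
      simp at htw
      tauto
    rcases htr with htp | htr
    · have hc : w.toList.count t = 1 := h1
      obtain ⟨p1, p2, rfl⟩ := List.append_of_mem htp
      have : p1.length = p'.length := by
        have e : p1 ++ t :: (p2 ++ a :: (q ++ a :: r)) = p' ++ t :: s' := by
          rw [← hw', hw]; simp
        have hc1 : t ∉ p1 := by
          intro hh
          rw [hw] at hc
          simp [List.count_append] at hc
          have := List.count_pos_iff.mpr hh
          omega
        have e' := congrArg (List.idxOf t) e
        simpa [List.idxOf_append_of_notMem, hc1, hp'] using e'
      have e : p1 ++ t :: (p2 ++ a :: (q ++ a :: r)) = p' ++ t :: s' := by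
        rw [← hw', hw]; simp
      have := (List.append_inj e this).1
      subst this
      exact hp (by simp [hap])
    · apply h4
      have : [a, a, t] = [] ++ a :: ([] ++ a :: [t]) := rfl
      rw [this]
      exact (List.nil_sublist p).append
        (((List.nil_sublist q).append ((List.singleton_sublist.mpr htr).cons_cons a)).cons_cons a)
  · intro h
    have h1 : a ∈ w.toList := List.count_pos_iff.mp (by omega)
    obtain ⟨p, s, hw, hp⟩ := List.eq_append_cons_of_mem h1
    have h2 : a ∈ s := by
      rw [hw, List.count_append, List.count_cons_self, List.count_eq_zero.mpr hp] at ha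
      exact List.count_pos_iff.mp (by omega)
    obtain ⟨q, r, rfl, hq⟩ := List.eq_append_cons_of_mem h2
    refine ⟨p, q, r, hw, hp, hq, fun t ht hst => h ⟨t, hst, ?_, ?_⟩⟩
    · rw [hw]
      have : [a, t, a] = [] ++ a :: ([t] ++ a :: []) := rfl
      rw [this]
      exact (List.nil_sublist p).append
        (((List.singleton_sublist.mpr ht).append ((List.nil_sublist r).cons_cons a)).cons_cons a)
    · intro hsub
      obtain ⟨q1, q2, rfl⟩ := List.append_of_mem ht
      have hc : w.toList.count t = 1 := hst
      have hat : a ≠ t := by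
        rintro rfl; simp at hq
      rw [hw] at hc hsub
      have e : p ++ a :: (q1 ++ t :: q2 ++ a :: r) = (p ++ a :: q1) ++ t :: (q2 ++ a :: r) := by
        simp
      rw [e] at hc hsub
      rw [List.count_append, List.count_cons_self] at hc
      have n2 : t ∉ q2 ++ a :: r := List.count_eq_zero.mp (by omega)
      have h3 : [a, a].Sublist (p ++ a :: q1) := by
        have n1 : t ∉ p ++ a :: q1 := List.count_eq_zero.mp (by omega)
        rcases sublist_three hsub with h | ⟨h, -⟩ | ⟨-, h⟩ | h
        · exact absurd (h.subset (by simp)) n1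
        · exact h
        · rcases List.sublist_cons_iff.mp h with h | ⟨r, hr, -⟩
          · exact absurd (h.subset (by simp)) n2
          · exact absurd (List.cons.inj hr).1 hat
        · rcases List.sublist_cons_iff.mp h with h | ⟨r, hr, -⟩
          · exact absurd (h.subset (by simp)) n2
          · exact absurd (List.cons.inj hr).1 hat
      have h4 := h3.count_le a
      have n3 : a ∉ q1 := fun hh => hq (by simp [hh])
      simp [List.count_append, List.count_eq_zero.mpr hp, List.count_eq_zero.mpr n3] at h4

theorem sep_transfer {u v : Word} (h : GammaRel u v) {a t t₁ : Letter} (ht : Sep a t u)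
    (ht₁ : Sep a t₁ v) : Sep a t v := by
  obtain ⟨h1, h2, h3⟩ := ht
  obtain ⟨k1, k2, k3⟩ := ht₁
  have hat : a ≠ t := by
    obtain ⟨_, _, _, _, _, _, _, hat⟩ := sublist_split h2 h1
    exact hat
  refine ⟨(h.1 t).mp h1, h.sublist (by simp [hat, hat.symm]) h2, fun hs => h3 ?_⟩
  obtain ⟨p, s, hv, hp, hs', hap, has, hat₁⟩ := sublist_split k2 k1
  have : [a, t].Sublist (t₁ :: s) := by
    rw [hv] at hs k3
    have h5 : ¬ [a, a].Sublist p := fun h5 =>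
      k3 (h5.append ((List.nil_sublist s).cons_cons t₁))
    rcases sublist_three hs with h | ⟨h, -⟩ | ⟨-, h⟩ | h
    · exact absurd (List.Sublist.trans (by simp) h) h5
    · exact absurd h h5
    · exact h
    · exact (List.sublist_cons_self _ _).trans h
  have h6 : [a, t].Sublist s := by
    rcases List.sublist_cons_iff.mp this with h | ⟨r, hr, -⟩
    · exact h
    · exact absurd (List.cons.inj hr).1 hat₁
  have h7 : [a, t₁, a, t].Sublist v.toList := by
    rw [hv]
    exact (List.singleton_sublist.mpr hap).append (h6.cons_cons t₁)
  have h8 := h.symm.sublist (by simp [hat, hat₁, hat₁.symm]) h7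
  refine List.Sublist.trans ?_ h8
  exact List.Sublist.cons_cons a (List.sublist_cons_self _ _)

theorem sep_multiple {a t : Letter} {w : Word} (h : Sep a t w) : IsMultiple a w := by
  obtain ⟨p, s, hw, _, _, hap, has, hat⟩ := sublist_split h.2.1 h.1
  unfold IsMultiple
  rw [hw, List.count_append, List.count_cons]
  have := List.count_pos_iff.mpr hap
  have := List.count_pos_iff.mpr has
  omega

theorem GammaRel.multiple_iff {u v : Word} (h : GammaRel u v) (a : Letter) :
    IsMultiple a u ↔ IsMultiple a v := by
  have := h.count_cases a
  unfold IsMultiple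
  omega

theorem betaRel_iff {u v : Word} :
    BetaRel u v ↔ GammaRel u v ∧ ∀ a t, Sep a t u ↔ Sep a t v := by
  constructor
  · rintro ⟨h, hb⟩
    refine ⟨h, fun a t => ⟨fun hs => ?_, fun hs => ?_⟩⟩
    · have hm := sep_multiple hs
      have := hb a hm
      rw [firstTwo_iff hm, firstTwo_iff ((h.multiple_iff a).mp hm), not_iff_not] at this
      obtain ⟨t₁, ht₁⟩ := this.mp ⟨t, hs⟩
      exact sep_transfer h hs ht₁
    · have hm := (h.multiple_iff a).mpr (sep_multiple hs)
      have := hb a hm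
      rw [firstTwo_iff hm, firstTwo_iff ((h.multiple_iff a).mp hm), not_iff_not] at this
      obtain ⟨t₁, ht₁⟩ := this.mpr ⟨t, hs⟩
      exact sep_transfer h.symm hs ht₁
  · rintro ⟨h, hb⟩
    refine ⟨h, fun a hm => ?_⟩
    rw [firstTwo_iff hm, firstTwo_iff ((h.multiple_iff a).mp hm), not_iff_not]
    simp only [hb]

theorem BetaRel.symm {u v : Word} (h : BetaRel u v) : BetaRel v u := by
  rw [betaRel_iff] at h ⊢
  exact ⟨h.1.symm, fun a t => (h.2 a t).symm⟩

theorem BetaRel.trans {u v w : Word} (h : BetaRel u v) (h' : BetaRel v w) : BetaRel u w := by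
  rw [betaRel_iff] at h h' ⊢
  exact ⟨h.1.trans h'.1, fun a t => (h.2 a t).trans (h'.2 a t)⟩

theorem sublist_pair_append {a t : Letter} {l m : List Letter} :
    [a, a, t].Sublist (l ++ m) ↔ [a, a, t].Sublist l ∨ ([a, a].Sublist l ∧ t ∈ m) ∨
      (a ∈ l ∧ [a, t].Sublist m) ∨ [a, a, t].Sublist m := by
  constructor
  · exact sublist_three
  · rintro (h | ⟨h, h'⟩ | ⟨h, h'⟩ | h)
    · exact h.trans (List.sublist_append_left _ _)
    · exact h.append (List.singleton_sublist.mpr h')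
    · exact (List.singleton_sublist.mpr h).append h'
    · exact h.trans (List.sublist_append_right _ _)

theorem two_sublist_iff {a : Letter} {l : List Letter} : [a, a].Sublist l ↔ 2 ≤ l.count a :=
  List.replicate_sublist_iff (n := 2)

theorem sep_mul_right {u v : Word} (h : GammaRel u v) (hb : ∀ a t, Sep a t u ↔ Sep a t v)
    (w : Word) (a t : Letter) (hs : Sep a t (u * w)) : Sep a t (v * w) := by
  have hγ : GammaRel (u * w) (v * w) := h.mul ⟨fun _ => Iff.rfl, rfl⟩
  obtain ⟨h1, h2, h3⟩ := hs
  have hat : a ≠ t := by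
    obtain ⟨_, _, _, _, _, _, _, hat⟩ := sublist_split h2 h1
    exact hat
  refine ⟨(hγ.1 t).mp h1, hγ.sublist (by simp [hat, hat.symm]) h2, fun hs => ?_⟩
  unfold IsSimple at h1
  have ca := h.count_cases a
  have ct := h.count_cases t
  have hma := h.mem_iff a
  simp only [FreeMonoid.toList_mul] at h1 h2 h3 hs
  rw [sublist_pair_append] at h3 hs
  push Not at h3
  obtain ⟨n1, n2, n3, n4⟩ := h3
  rcases hs with hs | ⟨hs, hs'⟩ | ⟨hs, hs'⟩ | hs
  · have htv : t ∈ v.toList := hs.subset (by simp)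
    have htu := (h.mem_iff t).mpr htv
    have htu' := List.count_pos_iff.mpr htu
    rw [List.count_append] at h1
    have htw : t ∉ w.toList := List.count_eq_zero.mp (by omega)
    have hav : 2 ≤ v.toList.count a := by
      have := hs.count_le a
      simp [hat.symm] at this
      omega
    have hau : [a, a].Sublist u.toList := two_sublist_iff.mpr (by omega)
    obtain ⟨p, s, hu, hp, hs2⟩ : ∃ p s, u.toList = p ++ t :: s ∧ t ∉ p ∧ t ∉ s := by
      obtain ⟨p, s, hu⟩ := List.append_of_mem htu
      rw [hu, List.count_append, List.count_cons_self] at h1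
      exact ⟨p, s, hu, List.count_eq_zero.mp (by omega), List.count_eq_zero.mp (by omega)⟩
    have hap : a ∈ p := by
      rw [hu, List.append_assoc, List.cons_append] at h2
      exact (sublist_mid hp (by simp [hs2, htw]) hat h2).1
    have has : a ∈ s := by
      by_contra has
      apply n1
      rw [hu]
      have : 2 ≤ p.count a := by
        have h9 := two_sublist_iff.mp hau
        rw [hu, List.count_append, List.count_cons, List.count_eq_zero.mpr has] at h9
        simpa [hat.symm] using h9
      exact (two_sublist_iff.mpr this).append ((List.nil_sublist s).cons_cons t)
    have hsep : Sep a t u := by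
      refine ⟨by unfold IsSimple; omega, ?_, n1⟩
      rw [hu]
      exact (List.singleton_sublist.mpr hap).append ((List.singleton_sublist.mpr has).cons_cons t)
    exact ((hb a t).mp hsep).2.2 hs
  · rw [two_sublist_iff] at hs
    exact n2 (two_sublist_iff.mpr (by omega)) hs'
  · exact n3 (hma.mpr hs) hs'
  · exact n4 hs

theorem sep_mul_left {u v : Word} (h : GammaRel u v) (hb : ∀ a t, Sep a t u ↔ Sep a t v)
    (w : Word) (a t : Letter) (hs : Sep a t (w * u)) : Sep a t (w * v) := by
  have hγ : GammaRel (w * u) (w * v) := GammaRel.mul ⟨fun _ => Iff.rfl, rfl⟩ h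
  obtain ⟨h1, h2, h3⟩ := hs
  have hat : a ≠ t := by
    obtain ⟨_, _, _, _, _, _, _, hat⟩ := sublist_split h2 h1
    exact hat
  refine ⟨(hγ.1 t).mp h1, hγ.sublist (by simp [hat, hat.symm]) h2, fun hs => ?_⟩
  unfold IsSimple at h1
  have ct := h.count_cases t
  have hmt := h.mem_iff t
  have hsub : [a, t].Sublist v.toList → [a, t].Sublist u.toList := h.symm.sublist (by simp [hat])
  simp only [FreeMonoid.toList_mul] at h1 h2 h3 hs
  rw [sublist_pair_append] at h3 hs
  push Not at h3
  obtain ⟨n1, n2, n3, n4⟩ := h3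
  rcases hs with hs | ⟨hs, hs'⟩ | ⟨hs, hs'⟩ | hs
  · exact n1 hs
  · exact n2 hs (hmt.mpr hs')
  · exact n3 hs (hsub hs')
  · have hat' : [a, t].Sublist u.toList := hsub ((List.sublist_cons_self _ _).trans hs)
    have haw : a ∉ w.toList := fun hh => n3 hh hat'
    have htu := List.count_pos_iff.mpr (hmt.mpr (hs.subset (by simp)))
    rw [List.count_append] at h1
    have hsep : Sep a t u := by
      refine ⟨by unfold IsSimple; omega, ?_, n4⟩
      rcases sublist_three h2 with h | ⟨h, -⟩ | ⟨h, -⟩ | h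
      · exact absurd (h.subset (by simp)) haw
      · exact absurd (h.subset (by simp)) haw
      · exact absurd h haw
      · exact h
    exact ((hb a t).mp hsep).2.2 hs

theorem BetaRel.mul {u v u' v' : Word} (h : BetaRel u v) (h' : BetaRel u' v') :
    BetaRel (u * u') (v * v') := by
  have r : ∀ {a b : Word}, BetaRel a b → ∀ c, BetaRel (a * c) (b * c) := by
    intro a b hab c
    have hba := hab.symm
    rw [betaRel_iff] at hab hba ⊢
    exact ⟨hab.1.mul ⟨fun _ => Iff.rfl, rfl⟩, fun d t =>
      ⟨sep_mul_right hab.1 hab.2 c d t, sep_mul_right hba.1 hba.2 c d t⟩⟩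
  have l : ∀ {a b : Word}, BetaRel a b → ∀ c, BetaRel (c * a) (c * b) := by
    intro a b hab c
    have hba := hab.symm
    rw [betaRel_iff] at hab hba ⊢
    exact ⟨GammaRel.mul ⟨fun _ => Iff.rfl, rfl⟩ hab.1, fun d t =>
      ⟨sep_mul_left hab.1 hab.2 c d t, sep_mul_left hba.1 hba.2 c d t⟩⟩
  exact (r h u').trans (l h' v)

/-- The congruence `β` on the free monoid. -/
def beta : Con Word where
  r := BetaRel
  iseqv := ⟨fun _ => ⟨⟨fun _ => Iff.rfl, rfl⟩, fun _ _ => Iff.rfl⟩, BetaRel.symm, BetaRel.trans⟩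
  mul' := BetaRel.mul

open FreeMonoid in
/-- The word `a_{0,k}[π] = x (z_{1π} y_1² z_{2π} y_2² ⋯ y_{k-1}² z_{kπ}) x (t_1 z_1 ⋯ t_k z_k)`,
with the indices `1, …, k` shifted to `0, …, k - 1`. -/
def a0 (k : ℕ) (π : Equiv.Perm (Fin k)) : Word :=
  of Letter.x *
    (List.ofFn fun i : Fin k =>
      of (Letter.z (π i)) * (if (i : ℕ) + 1 < k then of (Letter.y i) ^ 2 else 1)).prod *
  of Letter.x *
    (List.ofFn fun i : Fin k => of (Letter.t i) * of (Letter.z i)).prod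

end Word

/-! ### Rees quotients and the monoids `M_α(W)` -/

/-- The Rees congruence of a two-sided ideal `I` of a monoid: it collapses `I` to a point. -/
def reesCon {M : Type*} [Monoid M] (I : Set M)
    (hl : ∀ a, ∀ b ∈ I, a * b ∈ I) (hr : ∀ a ∈ I, ∀ b, a * b ∈ I) : Con M where
  r a b := a = b ∨ (a ∈ I ∧ b ∈ I)
  iseqv := by
    refine ⟨fun _ => Or.inl rfl, ?_, ?_⟩
    · rintro a b (rfl | ⟨h, h'⟩)
      · exact Or.inl rfl
      · exact Or.inr ⟨h', h⟩
    · rintro a b c (rfl | ⟨h, h'⟩) (rfl | ⟨k, k'⟩)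
      · exact Or.inl rfl
      · exact Or.inr ⟨k, k'⟩
      · exact Or.inr ⟨h, h'⟩
      · exact Or.inr ⟨h, k'⟩
  mul' := by
    rintro a b c d (rfl | ⟨h, h'⟩) (rfl | ⟨k, k'⟩)
    · exact Or.inl rfl
    · exact Or.inr ⟨hl _ _ k, hl _ _ k'⟩
    · exact Or.inr ⟨hr _ h _, hr _ h' _⟩
    · exact Or.inr ⟨hr _ h _, hr _ h' _⟩

/-- The closure of a set `W` of elements of a monoid under taking factors. -/
def factorClosure {M : Type*} [Monoid M] (W : Set M) : Set M :=
  {c | ∃ w ∈ W, ∃ p s, w = p * c * s}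

/-- The congruence on `X*/α` whose quotient is `M_α(W)`: the Rees congruence of the ideal of all
`α`-classes that are not factors of any `α`-class in `W`. -/
def sapirCon (α : Con Word) (W : Set α.Quotient) : Con α.Quotient :=
  reesCon (factorClosure W)ᶜ
    (by
      rintro a b hb ⟨w, hw, p, s, h⟩
      exact hb ⟨w, hw, p * a, s, by rw [h]; simp only [mul_assoc]⟩)
    (by
      rintro a ha b ⟨w, hw, p, s, h⟩
      exact ha ⟨w, hw, p, b * s, by rw [h]; simp only [mul_assoc]⟩)

/-- The monoid `M_α(W)`. -/
abbrev SapirMonoid (α : Con Word) (W : Set α.Quotient) : Type := (sapirCon α W).Quotient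

/-! ### Varieties of monoids -/

/-- An identity `u ≈ v`, where `u` and `v` are words. -/
abbrev MonoidIdentity : Type := Word × Word

/-- The monoid `M` satisfies the identity `e`: every substitution of elements of `M` for the
letters gives both sides of `e` the same value. -/
def Satisfies (M : Type*) [Monoid M] (e : MonoidIdentity) : Prop :=
  ∀ φ : Letter → M, FreeMonoid.lift φ e.1 = FreeMonoid.lift φ e.2

/-- A variety of monoids: the class of all monoids satisfying some set of identities. -/
@[ext]
structure MonoidVariety where
  carrier : Set MonCat.{u}
  exists_identities : ∃ E : Set MonoidIdentity, carrier = {M : MonCat.{u} | ∀ e ∈ E, Satisfies M e}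

namespace MonoidVariety

/-- The variety given by a set of identities. -/
def ofIdentities (E : Set MonoidIdentity) : MonoidVariety.{u} :=
  ⟨{M : MonCat.{u} | ∀ e ∈ E, Satisfies M e}, E, rfl⟩

/-- The set of all identities that hold in every monoid of the variety. -/
def identities (V : MonoidVariety.{u}) : Set MonoidIdentity :=
  {e | ∀ M ∈ V.carrier, Satisfies M e}

/-- Varieties are ordered by inclusion. -/
instance : PartialOrder MonoidVariety.{u} :=
  PartialOrder.lift carrier (fun _ _ h => MonoidVariety.ext h)

theorem le_ofIdentities_iff {V : MonoidVariety.{u}} {E : Set MonoidIdentity} :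
    V ≤ ofIdentities E ↔ E ⊆ V.identities :=
  ⟨fun h e he _ hM => h hM e he, fun h M hM _ he => h he M hM⟩

theorem ofIdentities_identities (V : MonoidVariety.{u}) : ofIdentities V.identities = V := by
  obtain ⟨c, E, rfl⟩ := V
  refine le_antisymm (fun _ hM e he => hM e fun _ hN => hN e he) ?_
  exact le_ofIdentities_iff.mpr subset_rfl

/-- The lattice of varieties: the meet is the intersection, and the join is the variety given by
the identities that hold in both varieties. -/
instance : Lattice MonoidVariety.{u} where
  inf V W := ⟨V.carrier ∩ W.carrier, by
    obtain ⟨E, hE⟩ := V.exists_identities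
    obtain ⟨F, hF⟩ := W.exists_identities
    refine ⟨E ∪ F, ?_⟩
    rw [hE, hF]
    ext M
    simp only [Set.mem_inter_iff, Set.mem_ofPred_eq, Set.mem_union, or_imp, forall_and]⟩
  sup V W := ofIdentities (V.identities ∩ W.identities)
  inf_le_left _ _ := Set.inter_subset_left
  inf_le_right _ _ := Set.inter_subset_right
  le_inf _ _ _ h h' := Set.subset_inter h h'
  le_sup_left _ _ := le_ofIdentities_iff.mpr Set.inter_subset_left
  le_sup_right _ _ := le_ofIdentities_iff.mpr Set.inter_subset_right
  sup_le V W U h h' := by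
    rw [← ofIdentities_identities U, le_ofIdentities_iff] at h h'
    intro M hM
    rw [← ofIdentities_identities U]
    exact fun e he => hM e ⟨h he, h' he⟩

/-- The variety generated by a monoid. -/
def generatedBy (M : Type v) [Monoid M] : MonoidVariety.{u} :=
  ofIdentities {e | Satisfies M e}

theorem isLeast_generatedBy (M : Type u) [Monoid M] :
    IsLeast {V : MonoidVariety.{u} | MonCat.of M ∈ V.carrier} (generatedBy M) := by
  refine ⟨fun e he => he, fun V hV => ?_⟩
  rw [← ofIdentities_identities V]
  exact fun N hN e he => hN e (he _ hV)

/-- The lattice of subvarieties of a variety, ordered by inclusion. -/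
abbrev Subvarieties (V : MonoidVariety.{u}) : Type _ := Set.Iic V

/-- A variety is distributive if its lattice of subvarieties is distributive. -/
def IsDistributive (V : MonoidVariety.{u}) : Prop :=
  ∀ X Y Z : V.Subvarieties, X ⊓ (Y ⊔ Z) = (X ⊓ Y) ⊔ (X ⊓ Z)

end MonoidVariety

/-!
Let `w p q` be the word that arises from `a0 k π` when the first and the last `z`-letter of its
block are replaced by `f₀ f₁ f₂` and `l₀ l₁ l₂`, respectively (and, in a suitable order, after the
block), and an additional `x` is inserted after `f₀` if `p = 1` and before `l₂` if `q = 1`. If `X`,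
`Y`, `Z` are the subvarieties given by `w 0 1 ≈ w 1 0`, `w 0 0 ≈ w 0 1` and `w 0 0 ≈ w 1 0`, then
`w 0 0 ≈ w 0 1` holds in `X ∧ Y` and in `X ∧ Z`. It fails in `X ∧ (Y ∨ Z)`, which contains the
syntactic monoid of a language `K ∩ K'` such that the syntactic monoid of `K` lies in `Y` and that
of `K'` in `Z`.

Both languages consist of the words whose images under finitely many substitutions lie in the
`β`-class of `a0 k π`, so that their syntactic monoids belong to the variety. A substitution that
maps some `w p q` into the class either erases `x` or turns the whole block into a power of a
letter, in which case the additional `x` does not matter, or it maps the block onto that of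
`a0 k π` and one of the `fᵢ` and one of the `lⱼ` to the outer `z`-letters. In the second case, the
letters before this `fᵢ` and after this `lⱼ` are mapped to powers of `x`, so that an additional `x`
matters only for `i = 0`, respectively `j = 2`. For `K` the substitutions are chosen such that
`j ≠ 2`, for `K'` such that `i ≠ 0`, and together they exclude the second case if `p = 1` or
`q = 1`.
-/

/-! ### Identities, syntactic monoids and distributivity -/

theorem Satisfies.symm {M : Type*} [Monoid M] {u v : Word} (h : Satisfies M (u, v)) :
    Satisfies M (v, u) :=
  fun φ => (h φ).symm

theorem Satisfies.trans {M : Type*} [Monoid M] {u v w : Word} (h : Satisfies M (u, v))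
    (h' : Satisfies M (v, w)) : Satisfies M (u, w) :=
  fun φ => (h φ).trans (h' φ)

theorem Satisfies.of_injective {M N : Type*} [Monoid M] [Monoid N] {e : MonoidIdentity}
    (h : Satisfies N e) (f : M →* N) (hf : Function.Injective f) : Satisfies M e := fun φ =>
  hf (by simpa only [FreeMonoid.hom_map_lift] using h (f ∘ φ))

theorem satisfies_congr {M N : Type*} [Monoid M] [Monoid N] (f : M ≃* N) {e : MonoidIdentity} :
    Satisfies M e ↔ Satisfies N e :=
  ⟨fun h => h.of_injective f.symm.toMonoidHom f.symm.injective,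
    fun h => h.of_injective f.toMonoidHom f.injective⟩

theorem coe_lift_quotient {M : Type*} [Monoid M] (c : Con M) (θ : Letter → M) (w : Word) :
    ((FreeMonoid.lift θ w : M) : c.Quotient) = FreeMonoid.lift (fun a => (θ a : c.Quotient)) w :=
  FreeMonoid.hom_map_lift c.mk' θ w

theorem satisfies_quotient_iff {M : Type*} [Monoid M] (c : Con M) {e : MonoidIdentity} :
    Satisfies c.Quotient e ↔
      ∀ θ : Letter → M, c (FreeMonoid.lift θ e.1) (FreeMonoid.lift θ e.2) := by
  refine ⟨fun h θ => (Con.eq c).mp ?_, fun h φ => ?_⟩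
  · simpa only [coe_lift_quotient] using h fun a => (θ a : c.Quotient)
  · choose θ hθ using fun a => Con.mk'_surjective (c := c) (φ a)
    obtain rfl : (fun a => (θ a : c.Quotient)) = φ := funext hθ
    simpa only [coe_lift_quotient] using (Con.eq c).mpr (h θ)

/-- The syntactic congruence of a subset `K` of a monoid: the coarsest congruence of which `K` is
a union of classes. -/
def syntacticCon {M : Type*} [Monoid M] (K : Set M) : Con M where
  r a b := ∀ p s, p * a * s ∈ K ↔ p * b * s ∈ K
  iseqv := ⟨fun _ _ _ => Iff.rfl, fun h p s => (h p s).symm,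
    fun h h' p s => (h p s).trans (h' p s)⟩
  mul' := by
    intro a b c d hab hcd p s
    have hac : p * (a * c) * s ∈ K ↔ p * (b * c) * s ∈ K := by
      simpa only [mul_assoc] using hab p (c * s)
    have hcb : p * (b * c) * s ∈ K ↔ p * (b * d) * s ∈ K := by
      simpa only [mul_assoc] using hcd (p * b) s
    exact hac.trans hcb

/-- The syntactic monoid of a language, as an object of the category in which the members of a
`MonoidVariety` live. -/
def syntacticMonoid (K : Set Word) : MonCat.{u} :=
  MonCat.of (ULift.{u} (syntacticCon K).Quotient)

theorem satisfies_syntacticMonoid_iff {K : Set Word} {e : MonoidIdentity} :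
    Satisfies (syntacticMonoid.{u} K) e ↔ ∀ (θ : Letter → Word) (p s : Word),
      p * FreeMonoid.lift θ e.1 * s ∈ K ↔ p * FreeMonoid.lift θ e.2 * s ∈ K :=
  (satisfies_congr MulEquiv.ulift).trans (satisfies_quotient_iff _)

theorem Satisfies.mem_iff_mem {K : Set Word} {u v : Word}
    (h : Satisfies (syntacticMonoid.{u} K) (u, v)) : u ∈ K ↔ v ∈ K := by
  have hid : FreeMonoid.lift FreeMonoid.of = MonoidHom.id Word :=
    FreeMonoid.lift_restrict (MonoidHom.id Word)
  simpa only [hid, MonoidHom.id_apply, one_mul, mul_one] using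
    satisfies_syntacticMonoid_iff.mp h FreeMonoid.of 1 1

theorem satisfies_syntacticMonoid_inter {K K' : Set Word} {e : MonoidIdentity}
    (h : Satisfies (syntacticMonoid.{u} K) e) (h' : Satisfies (syntacticMonoid.{u} K') e) :
    Satisfies (syntacticMonoid.{u} (K ∩ K')) e :=
  satisfies_syntacticMonoid_iff.mpr fun θ p s =>
    and_congr (satisfies_syntacticMonoid_iff.mp h θ p s) (satisfies_syntacticMonoid_iff.mp h' θ p s)

/-- All factors of an `α`-class that belongs to `W` survive in the Rees quotient. -/
theorem SapirMonoid.rel_of_satisfies {α : Con Word} {W : Set α.Quotient} {e : MonoidIdentity}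
    (h : Satisfies (SapirMonoid α W) e) {w : Word} (hw : (w : α.Quotient) ∈ W)
    {θ : Letter → Word} {p s : Word} (hα : α (p * FreeMonoid.lift θ e.1 * s) w) :
    α (p * FreeMonoid.lift θ e.2 * s) w := by
  have hmem : ((FreeMonoid.lift θ e.1 : Word) : α.Quotient) ∈ factorClosure W :=
    ⟨w, hw, p, s, ((Con.eq α).mpr hα).symm⟩
  have hrel := (satisfies_quotient_iff (sapirCon α W)).mp h fun a => (θ a : α.Quotient)
  simp only [← coe_lift_quotient] at hrel
  rcases hrel with heq | ⟨hnot, -⟩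
  · have hθ : α (FreeMonoid.lift θ e.2) (FreeMonoid.lift θ e.1) := α.symm ((Con.eq α).mp heq)
    exact α.trans (α.mul (α.mul (α.refl p) hθ) (α.refl s)) hα
  · exact absurd hmem hnot

namespace MonoidVariety

/-- In the subvarieties `X`, `Y`, `Z` of `V` given by `v ≈ w`, `u ≈ v` and `u ≈ w`, the identity
`u ≈ v` holds in `X ⊓ Y` and in `X ⊓ Z`, but it fails in `L`, which belongs to `X ⊓ (Y ⊔ Z)`. -/
theorem not_isDistributive_of_not_satisfies {V : MonoidVariety.{u}} {L M N : MonCat.{u}}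
    {u v w : Word} (hM : M ∈ V.carrier) (hN : N ∈ V.carrier) (hMuv : Satisfies M (u, v))
    (hNuw : Satisfies N (u, w)) (hLvw : Satisfies L (v, w))
    (hL : ∀ e, Satisfies M e → Satisfies N e → Satisfies L e) (hLuv : ¬ Satisfies L (u, v)) :
    ¬ V.IsDistributive := by
  intro hdist
  let sub (e : MonoidIdentity) : V.Subvarieties :=
    ⟨V ⊓ ofIdentities {e}, Set.mem_Iic.mpr inf_le_left⟩
  have mem_sub {S : MonCat.{u}} {e : MonoidIdentity} (hS : S ∈ V.carrier) (he : Satisfies S e) :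
      S ∈ (sub e).1.carrier := ⟨hS, by rintro _ rfl; exact he⟩
  have hLV : L ∈ V.carrier := by
    rw [← ofIdentities_identities V]
    exact fun e he => hL e (he M hM) (he N hN)
  have hLsup : L ∈ (sub (u, v) ⊔ sub (u, w)).1.carrier := fun e he =>
    hL e (he.1 M (mem_sub hM hMuv)) (he.2 N (mem_sub hN hNuw))
  have hle : sub (v, w) ⊓ (sub (u, v) ⊔ sub (u, w)) ≤ sub (u, v) := by
    rw [hdist]
    refine sup_le inf_le_right ?_
    rintro S ⟨⟨hS, hvw⟩, -, huw⟩
    exact mem_sub hS ((huw _ rfl).trans (hvw _ rfl).symm)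
  exact hLuv ((hle ⟨mem_sub hLV hLvw, hLsup⟩).2 _ rfl)

end MonoidVariety

namespace Word

/-! ### Lists -/

theorem toList_lift (θ : Letter → Word) (w : Word) :
    (FreeMonoid.lift θ w).toList = w.toList.flatMap fun a => (θ a).toList := by
  rw [FreeMonoid.lift_apply, FreeMonoid.toList_prod, List.map_map, List.flatMap_def]
  rfl

section
variable {α β : Type*}

theorem sublist_flatMap_of_forall₂_mem {g : α → List β} {bs : List β} {as l : List α}
    (h : List.Forall₂ (fun b a => b ∈ g a) bs as) (hs : as.Sublist l) :
    bs.Sublist (l.flatMap g) := by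
  refine List.Sublist.trans ?_ (hs.flatMap g)
  clear hs
  induction h with
  | nil => exact List.nil_sublist _
  | cons hb _ ih => exact (List.singleton_sublist.mpr hb).append ih

theorem pair_sublist_flatten_ofFn {n : ℕ} {f : Fin n → List α} {i j : Fin n} (hij : i < j)
    {a b : α} (ha : a ∈ f i) (hb : b ∈ f j) : [a, b].Sublist (List.ofFn f).flatten := by
  induction n with
  | zero => exact i.elim0
  | succ n ih =>
    rw [List.ofFn_succ, List.flatten_cons]
    obtain ⟨j, rfl⟩ := Fin.exists_succ_eq.mpr (Fin.ne_zero_of_lt hij)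
    induction i using Fin.cases with
    | zero =>
      exact (List.singleton_sublist.mpr ha).append (List.singleton_sublist.mpr
        (List.mem_flatten.mpr ⟨_, List.mem_ofFn.mpr ⟨j, rfl⟩, hb⟩))
    | succ i =>
      exact (ih (Fin.succ_lt_succ_iff.mp hij) ha hb).trans (List.sublist_append_right _ _)

theorem flatten_ofFn_eq_of_forall_ne {n : ℕ} {f : Fin n → List α} (j : Fin n)
    (h : ∀ i, i ≠ j → f i = []) : (List.ofFn f).flatten = f j := by
  induction n with
  | zero => exact j.elim0
  | succ n ih =>
    rw [List.ofFn_succ, List.flatten_cons]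
    induction j using Fin.cases with
    | zero =>
      have hnil : ∀ i : Fin n, f i.succ = [] := fun i => h _ (Fin.succ_ne_zero i)
      simp only [hnil, List.ofFn_const, List.flatten_replicate_nil, List.append_nil]
    | succ j =>
      rw [h 0 (Fin.succ_ne_zero j).symm, List.nil_append]
      exact ih j fun i hi => h _ fun e => hi (Fin.succ_inj.mp e)

/-! ### Occurrences of letters in `a0 k π` -/

/-- The second components of `L` increase strictly and lie in the interval `[lo, hi)`. A list with
this property records letters together with the places where they stand. -/
def IsPlacedIn (lo hi : ℕ) (L : List (α × ℕ)) : Prop :=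
  (∀ p ∈ L, lo ≤ p.2 ∧ p.2 < hi) ∧ L.Pairwise fun p q => p.2 < q.2

theorem IsPlacedIn.append {a b c : ℕ} {L L' : List (α × ℕ)} (h : IsPlacedIn a b L)
    (h' : IsPlacedIn b c L') (hab : a ≤ b) (hbc : b ≤ c) : IsPlacedIn a c (L ++ L') := by
  refine ⟨fun p hp => ?_, List.pairwise_append.mpr ⟨h.2, h'.2, fun p hp q hq => ?_⟩⟩
  · rcases List.mem_append.mp hp with hp | hp
    · exact ⟨(h.1 p hp).1, (h.1 p hp).2.trans_le hbc⟩
    · exact ⟨hab.trans (h'.1 p hp).1, (h'.1 p hp).2⟩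
  · exact (h.1 p hp).2.trans_le (h'.1 q hq).1

theorem IsPlacedIn.flatten_ofFn {n : ℕ} {c : ℕ → ℕ} (hc : Monotone c)
    {f : Fin n → List (α × ℕ)} (h : ∀ i : Fin n, IsPlacedIn (c i) (c (i + 1)) (f i)) :
    IsPlacedIn (c 0) (c n) (List.ofFn f).flatten := by
  induction n with
  | zero => exact ⟨by simp, by simp⟩
  | succ n ih =>
    rw [List.ofFn_succ', List.concat_eq_append, List.flatten_append, List.flatten_singleton]
    exact (ih fun i => h i.castSucc).append (h (Fin.last n)) (hc n.zero_le) (hc n.le_succ)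

/-- The letters of a list stand at increasing places, all of them at least `b`; here `R a r` says
that the letter `a` stands at the place `r`. -/
def OccurInOrder (R : α → ℕ → Prop) : ℕ → List α → Prop
  | _, [] => True
  | b, a :: l => ∃ r, b ≤ r ∧ R a r ∧ OccurInOrder R (r + 1) l

theorem OccurInOrder.of_isPlacedIn {R : α → ℕ → Prop} {L : List (α × ℕ)} {lo hi : ℕ}
    (hL : IsPlacedIn lo hi L) (hR : ∀ p ∈ L, R p.1 p.2) : OccurInOrder R lo (L.map Prod.fst) := by
  induction L generalizing lo with
  | nil => trivial
  | cons p L ih =>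
    obtain ⟨hmem, hpair⟩ := hL
    rw [List.pairwise_cons] at hpair
    rw [List.forall_mem_cons] at hmem hR
    exact ⟨p.2, hmem.1.1, hR.1,
      ih ⟨fun q hq => ⟨hpair.1 q hq, (hmem.2 q hq).2⟩, hpair.2⟩ hR.2⟩

theorem OccurInOrder.exists_places {R : α → ℕ → Prop} {l : List α} {b : ℕ}
    (h : OccurInOrder R b l) : ∃ L : List (α × ℕ), L.map Prod.fst = l ∧
      (∀ p ∈ L, R p.1 p.2 ∧ b ≤ p.2) ∧ L.Pairwise fun p q => p.2 < q.2 := by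
  induction l generalizing b with
  | nil => exact ⟨[], rfl, by simp, .nil⟩
  | cons a l ih =>
    obtain ⟨r, hbr, hr, h⟩ := h
    obtain ⟨L, rfl, hL, hpair⟩ := ih h
    refine ⟨(a, r) :: L, rfl, List.forall_mem_cons.mpr ⟨⟨hr, hbr⟩, fun p hp => ?_⟩,
      List.pairwise_cons.mpr ⟨fun q hq => (hL q hq).2, hpair⟩⟩
    exact ⟨(hL p hp).1, (hbr.trans r.le_succ).trans (hL p hp).2⟩

theorem sublist_map_fst_iff_occurInOrder {L : List (α × ℕ)} {lo hi : ℕ} (hL : IsPlacedIn lo hi L)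
    {l : List α} :
    l.Sublist (L.map Prod.fst) ↔ OccurInOrder (fun a r => (a, r) ∈ L) lo l := by
  constructor
  · intro h
    obtain ⟨S, hS, rfl⟩ := List.sublist_map_iff.mp h
    exact .of_isPlacedIn ⟨fun p hp => hL.1 p (hS.subset hp), hL.2.sublist hS⟩
      fun p hp => hS.subset hp
  · intro h
    obtain ⟨S, rfl, hmem, hpair⟩ := h.exists_places
    have : Std.Antisymm fun p q : α × ℕ => p.2 < q.2 := ⟨fun p q h h' => absurd h h'.asymm⟩
    have hnodup : S.Nodup := hpair.imp fun h e => h.ne (congrArg Prod.snd e)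
    exact (List.sublist_of_subperm_of_pairwise
      (List.subperm_of_subset hnodup fun p hp => (hmem p hp).1) hpair hL.2).map _

end

section
variable {k : ℕ} (π : Equiv.Perm (Fin k))

/-- The index of the letter `z n` in the first block of `a0 k π`, with the junk value `0` if
`n ≥ k`. -/
def blockIndex (n : ℕ) : ℕ :=
  if h : n < k then π.symm ⟨n, h⟩ else 0

theorem blockIndex_lt {n : ℕ} (h : n < k) : blockIndex π n < k := by
  simp [blockIndex, h]

theorem blockIndex_apply (i : Fin k) : blockIndex π (π i) = i := by
  simp [blockIndex]

/-- The letter `a` stands at the place `r` of `a0 k π`. The places `3 * k - 1` and `3 * k` stay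
empty, so that each of the `k` factors of the first block fills up an interval of length `3`. -/
def OccursAt : Letter → ℕ → Prop
  | .x, r => r = 0 ∨ r = 3 * k + 1
  | .y n, r => n + 1 < k ∧ (r = 3 * n + 2 ∨ r = 3 * n + 3)
  | .z n, r => n < k ∧ (r = 3 * blockIndex π n + 1 ∨ r = 3 * k + 2 * n + 3)
  | .t n, r => n < k ∧ r = 3 * k + 2 * n + 2

/-- The factor `z_{iπ} y_i ^ 2` of `a0 k π`, with the places of its letters. -/
def blockOccurrences (i : Fin k) : List (Letter × ℕ) :=
  (.z (π i), 3 * i + 1) :: if (i : ℕ) + 1 < k then [(.y i, 3 * i + 2), (.y i, 3 * i + 3)] else []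

/-- The factor `t_i z_i` of `a0 k π`, with the places of its letters. -/
def tailOccurrences (i : Fin k) : List (Letter × ℕ) :=
  [(.t i, 3 * k + 2 * i + 2), (.z i, 3 * k + 2 * i + 3)]

/-- The letters of `a0 k π` with their places. -/
def occurrences : List (Letter × ℕ) :=
  [(.x, 0)] ++ (List.ofFn (blockOccurrences π)).flatten ++ [(.x, 3 * k + 1)] ++
    (List.ofFn (tailOccurrences (k := k))).flatten

theorem map_fst_occurrences : (occurrences π).map Prod.fst = (a0 k π).toList := by
  have hblock : List.map Prod.fst ∘ blockOccurrences π = FreeMonoid.toList ∘ fun i : Fin k =>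
      FreeMonoid.of (Letter.z (π i)) *
        if (i : ℕ) + 1 < k then FreeMonoid.of (Letter.y i) ^ 2 else 1 := by
    funext i
    by_cases h : (i : ℕ) + 1 < k <;> simp [blockOccurrences, h, pow_two]
  have htail : List.map Prod.fst ∘ tailOccurrences = FreeMonoid.toList ∘ fun i : Fin k =>
      FreeMonoid.of (Letter.t i) * FreeMonoid.of (Letter.z i) := by
    funext i
    simp [tailOccurrences]
  simp only [occurrences, a0, FreeMonoid.toList_mul, FreeMonoid.toList_of, FreeMonoid.toList_prod,
    List.map_ofFn, List.map_append, List.map_cons, List.map_nil, List.map_flatten, hblock, htail]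

theorem isPlacedIn_occurrences : IsPlacedIn 0 (3 * k + 2 + 2 * k) (occurrences π) := by
  have hblock : IsPlacedIn 1 (3 * k + 1) (List.ofFn (blockOccurrences π)).flatten := by
    refine IsPlacedIn.flatten_ofFn (c := fun i => 3 * i + 1) (fun i j h => by dsimp only; omega)
      fun i => ?_
    grind [IsPlacedIn, blockOccurrences]
  have htail : IsPlacedIn (3 * k + 2) (3 * k + 2 + 2 * k)
      (List.ofFn (tailOccurrences (k := k))).flatten := by
    refine IsPlacedIn.flatten_ofFn (c := fun i => 3 * k + 2 + 2 * i)
      (fun i j h => by dsimp only; omega) fun i => ?_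
    grind [IsPlacedIn, tailOccurrences]
  have hx (r : ℕ) : IsPlacedIn r (r + 1) [(Letter.x, r)] := by simp [IsPlacedIn]
  exact (((hx 0).append hblock (by omega) (by omega)).append (hx _) (by omega) (by omega)).append
    htail (by omega) (by omega)

theorem mem_occurrences_iff {a : Letter} {r : ℕ} : (a, r) ∈ occurrences π ↔ OccursAt π a r := by
  have hblock (i : Fin k) : (a, r) ∈ blockOccurrences π i ↔
      (a = .z (π i) ∧ r = 3 * i + 1) ∨
        (i : ℕ) + 1 < k ∧ a = .y i ∧ (r = 3 * i + 2 ∨ r = 3 * i + 3) := by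
    unfold blockOccurrences
    split_ifs with h <;> simp [h, and_or_left]
  simp only [occurrences, tailOccurrences, List.mem_append, List.mem_flatten, List.mem_ofFn,
    List.mem_cons, List.not_mem_nil, or_false, Prod.mk.injEq, exists_exists_eq_and, hblock]
  cases a with
  | x => simp [OccursAt]
  | y n =>
    suffices (∃ i : Fin k, (i : ℕ) + 1 < k ∧ n = i ∧ (r = 3 * i + 2 ∨ r = 3 * i + 3)) ↔
        n + 1 < k ∧ (r = 3 * n + 2 ∨ r = 3 * n + 3) by simpa [OccursAt]
    exact ⟨by rintro ⟨i, hi, rfl, h⟩; exact ⟨hi, h⟩,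
      fun ⟨hn, h⟩ => ⟨⟨n, Nat.lt_of_succ_lt hn⟩, hn, rfl, h⟩⟩
  | z n =>
    suffices ((∃ i : Fin k, n = π i ∧ r = 3 * i + 1) ∨
        ∃ i : Fin k, n = i ∧ r = 3 * k + 2 * i + 3) ↔
        n < k ∧ (r = 3 * blockIndex π n + 1 ∨ r = 3 * k + 2 * n + 3) by simpa [OccursAt]
    constructor
    · rintro (⟨i, rfl, h⟩ | ⟨i, rfl, h⟩)
      · exact ⟨(π i).2, .inl (by rw [h, blockIndex_apply])⟩
      · exact ⟨i.2, .inr h⟩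
    · rintro ⟨hn, h | h⟩
      · exact .inl ⟨π.symm ⟨n, hn⟩, by simp, by simp [h, blockIndex, hn]⟩
      · exact .inr ⟨⟨n, hn⟩, rfl, h⟩
  | t n =>
    suffices (∃ i : Fin k, n = i ∧ r = 3 * k + 2 * i + 2) ↔
        n < k ∧ r = 3 * k + 2 * n + 2 by simpa [OccursAt]
    exact ⟨by rintro ⟨i, rfl, h⟩; exact ⟨i.2, h⟩, fun ⟨hn, h⟩ => ⟨⟨n, hn⟩, rfl, h⟩⟩

theorem sublist_a0_iff_occurInOrder {l : List Letter} :
    l.Sublist (a0 k π).toList ↔ OccurInOrder (OccursAt π) 0 l := by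
  rw [← map_fst_occurrences, sublist_map_fst_iff_occurInOrder (isPlacedIn_occurrences π)]
  simp only [mem_occurrences_iff]

end

/-! ### Exponents inside a `β`-class -/

theorem destutter_replicate {c : Letter} {n : ℕ} (hn : n ≠ 0) :
    (List.replicate n c).destutter (· ≠ ·) = [c] := by
  obtain ⟨n, rfl⟩ := Nat.exists_eq_succ_of_ne_zero hn
  rw [List.replicate_succ, List.destutter_cons']
  induction n with
  | zero => rfl
  | succ n ih =>
    rw [List.replicate_succ, List.destutter'_cons_neg _ (by simp only [ne_eq, not_not]), ih]
    exact n.succ_ne_zero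

theorem sublist_iff_sublist_filter_ne {l w : List Letter} {e : Letter} (he : e ∉ l) :
    l.Sublist w ↔ l.Sublist (w.filter (· ≠ e)) := by
  refine ⟨fun h => ?_, fun h => h.trans List.filter_sublist⟩
  have hl : l.filter (· ≠ e) = l :=
    List.filter_eq_self.mpr fun a ha => decide_eq_true (ne_of_mem_of_not_mem ha he)
  exact hl ▸ h.filter (· ≠ e)

/-- Changing the exponent of `e` can violate `β` only through a simple letter that separates the
first two occurrences of `e`. -/
theorem betaRel_replicate_of_mem {P Q : List Letter} {e : Letter} {n : ℕ} (hn : n ≠ 0)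
    (he : e ∈ P ∨ e ∈ Q) (hsep : ∀ t, (P ++ [e] ++ Q).count t = 1 →
      ¬ [e, t, e].Sublist (P ++ [e] ++ Q)) :
    BetaRel (FreeMonoid.ofList (P ++ [e] ++ Q))
      (FreeMonoid.ofList (P ++ List.replicate n e ++ Q)) := by
  have he' : 0 < P.count e ∨ 0 < Q.count e := by simpa only [List.count_pos_iff] using he
  have hγ : GammaRel (FreeMonoid.ofList (P ++ [e] ++ Q))
      (FreeMonoid.ofList (P ++ List.replicate n e ++ Q)) := by
    refine ⟨fun a => ?_, destutter_append_congr (destutter_append_congr rfl ?_) rfl⟩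
    · simp only [IsSimple, FreeMonoid.toList_ofList, List.count_append, List.count_replicate,
        List.count_singleton]
      grind
    · rw [destutter_replicate hn, List.destutter_singleton]
  have ne_of_isSimple {t : Letter} (ht : IsSimple t (FreeMonoid.ofList (P ++ [e] ++ Q))) :
      t ≠ e := by
    rintro rfl
    simp only [IsSimple, FreeMonoid.toList_ofList, List.count_append,
      List.count_singleton_self] at ht
    omega
  refine betaRel_iff.mpr ⟨hγ, fun a t =>
    (and_congr_right fun ht => ?_).trans (and_congr_left' (hγ.1 t))⟩
  obtain rfl | hat := eq_or_ne a t
  · exact iff_of_false (fun h => h.2 h.1) fun h => h.2 h.1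
  have hchain : [a, t, a].IsChain (· ≠ ·) := by simp [hat, hat.symm]
  obtain rfl | hae := eq_or_ne a e
  · exact iff_of_false (fun h => hsep t ht h.1)
      fun h => hsep t ht (hγ.symm.sublist hchain h.1)
  · have hmem : e ∉ [a, a, t] := by simp [hae.symm, (ne_of_isSimple ht).symm]
    refine and_congr ⟨hγ.sublist hchain, hγ.symm.sublist hchain⟩ (not_congr ?_)
    rw [FreeMonoid.toList_ofList, FreeMonoid.toList_ofList, sublist_iff_sublist_filter_ne hmem,
      sublist_iff_sublist_filter_ne (w := P ++ List.replicate n e ++ Q) hmem]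
    simp

theorem betaRel_replicate (c : Letter) {m n : ℕ} (hm : 2 ≤ m) (hn : 2 ≤ n) :
    BetaRel (FreeMonoid.ofList (List.replicate m c)) (FreeMonoid.ofList (List.replicate n c)) := by
  have key {n : ℕ} (hn : 2 ≤ n) :
      BetaRel (FreeMonoid.ofList [c, c]) (FreeMonoid.ofList (List.replicate n c)) := by
    obtain ⟨n, rfl⟩ := Nat.exists_eq_add_of_le' hn
    rw [List.replicate_succ']
    refine betaRel_replicate_of_mem (P := []) (Q := [c]) n.succ_ne_zero (by simp) fun t ht => ?_
    by_cases hct : c = t <;> simp [hct] at ht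
  exact (key hm).symm.trans (key hn)

/-! ### The `β`-class of `a0 k π` -/

/-- The word with the list of letters `l` belongs to the `β`-class of `a0 k π`. -/
def InClass {k : ℕ} (π : Equiv.Perm (Fin k)) (l : List Letter) : Prop :=
  BetaRel (FreeMonoid.ofList l) (a0 k π)

section
variable {k : ℕ} {π : Equiv.Perm (Fin k)} {n r : ℕ}

theorem occursAt_x : OccursAt π .x r ↔ r = 0 ∨ r = 3 * k + 1 := Iff.rfl

theorem occursAt_y : OccursAt π (.y n) r ↔ n + 1 < k ∧ (r = 3 * n + 2 ∨ r = 3 * n + 3) := Iff.rfl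

theorem occursAt_z : OccursAt π (.z n) r ↔ n < k ∧ blockIndex π n < k ∧
    (r = 3 * blockIndex π n + 1 ∨ r = 3 * k + 2 * n + 3) :=
  and_congr_right fun h => (and_iff_right (blockIndex_lt π h)).symm

theorem occursAt_t : OccursAt π (.t n) r ↔ n < k ∧ r = 3 * k + 2 * n + 2 := Iff.rfl

theorem isSimple_t_a0 (hn : n < k) : IsSimple (.t n) (a0 k π) := by
  have hle : ¬ [.t n, .t n].Sublist (a0 k π).toList := by
    rw [sublist_a0_iff_occurInOrder]
    rintro ⟨r, -, hr, s, hrs, hs, -⟩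
    exact (Nat.lt_of_succ_le hrs).ne' (hs.2.trans hr.2.symm)
  have hpos : [.t n].Sublist (a0 k π).toList :=
    (sublist_a0_iff_occurInOrder π).mpr ⟨_, Nat.zero_le _, ⟨hn, rfl⟩, trivial⟩
  rw [two_sublist_iff] at hle
  rw [List.singleton_sublist, ← List.count_pos_iff] at hpos
  exact le_antisymm (Nat.le_of_lt_succ (not_le.mp hle)) hpos

theorem not_isSimple_a0_of_occursAt {a : Letter} (h : OccursAt π a r) (hr : r < 3 * k + 1) :
    ¬ IsSimple a (a0 k π) := by
  suffices [a, a].Sublist (a0 k π).toList by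
    rw [two_sublist_iff] at this
    exact fun h => this.not_gt (h.trans_lt one_lt_two)
  rw [sublist_a0_iff_occurInOrder]
  match a, h with
  | .x, _ => exact ⟨0, le_rfl, .inl rfl, 3 * k + 1, by omega, .inr rfl, trivial⟩
  | .y n, h => exact ⟨_, Nat.zero_le _, ⟨h.1, .inl rfl⟩, _, le_rfl, ⟨h.1, .inr rfl⟩, trivial⟩
  | .z n, h =>
    have := blockIndex_lt π h.1
    exact ⟨_, Nat.zero_le _, ⟨h.1, .inl rfl⟩, _, by omega, ⟨h.1, .inr rfl⟩, trivial⟩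
  | .t n, h => have := h.2; omega

end

namespace InClass

variable {k : ℕ} {π : Equiv.Perm (Fin k)} {l : List Letter} {n : ℕ}

theorem occurInOrder (h : InClass π l) {ls : List Letter} (hs : ls.Sublist l)
    (hc : ls.IsChain (· ≠ ·)) : OccurInOrder (OccursAt π) 0 ls :=
  (sublist_a0_iff_occurInOrder π).mp (GammaRel.sublist h.1 hc hs)

theorem sublist (h : InClass π l) {ls : List Letter} (hs : OccurInOrder (OccursAt π) 0 ls)
    (hc : ls.IsChain (· ≠ ·)) : ls.Sublist l :=
  GammaRel.sublist h.1.symm hc ((sublist_a0_iff_occurInOrder π).mpr hs)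

theorem count_t (h : InClass π l) (hn : n < k) : l.count (.t n) = 1 :=
  (h.1.1 _).mpr (isSimple_t_a0 hn)

theorem t_mem (h : InClass π l) (hn : n < k) : .t n ∈ l :=
  List.count_pos_iff.mp (zero_lt_one.trans_eq (h.count_t hn).symm)

theorem not_zzt (h : InClass π l) (hn : n < k) : ¬ [.z n, .z n, .t n].Sublist l := by
  have hlt := blockIndex_lt π hn
  have hzz : OccursAt π (.z n) (3 * blockIndex π n + 1) ∧ OccursAt π (.z n) (3 * k + 2 * n + 3) :=
    ⟨⟨hn, .inl rfl⟩, hn, .inr rfl⟩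
  have hsep : Sep (.z n) (.t n) (a0 k π) := by
    refine ⟨isSimple_t_a0 hn, ?_, ?_⟩ <;> rw [sublist_a0_iff_occurInOrder]
    · exact ⟨_, Nat.zero_le _, hzz.1, _, by omega, ⟨hn, rfl⟩, _, le_rfl, hzz.2, trivial⟩
    · rintro ⟨r, -, hr, s, hrs, hs, u, hsu, hu, -⟩
      simp only [occursAt_z, occursAt_t] at hr hs hu
      omega
  exact (((betaRel_iff.mp h).2 _ _).mpr hsep).2.2

theorem not_tx (h : InClass π l) : ¬ [.t n, .x].Sublist l := by
  intro hs
  obtain ⟨r, -, hr, s, hrs, hs, -⟩ := h.occurInOrder hs (by simp)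
  simp only [occursAt_t, occursAt_x] at hr hs
  omega

theorem not_zzx (h : InClass π l) (hn : n < k) : ¬ [.z n, .z n, .x].Sublist l := by
  intro hs
  obtain ⟨A, C, rfl⟩ := List.append_of_mem (h.t_mem hn)
  have hx : .x ∉ Letter.t n :: C := by
    intro hx
    have hxC : [.x].Sublist C := List.singleton_sublist.mpr
      ((List.mem_cons.mp hx).resolve_left Letter.noConfusion)
    exact h.not_tx (n := n) ((hxC.cons_cons _).trans (List.sublist_append_right A _))
  have hA : [Letter.z n, .z n].Sublist A := by
    rcases sublist_pair_append.mp hs with hA | ⟨hA, -⟩ | ⟨-, hC⟩ | hC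
    · exact List.Sublist.trans (by simp) hA
    · exact hA
    all_goals exact absurd (hC.subset (by simp)) hx
  exact h.not_zzt hn (hA.append (List.singleton_sublist.mpr List.mem_cons_self))

theorem not_xtx (h : InClass π l) {t : Letter} (ht : l.count t = 1) :
    ¬ [.x, t, .x].Sublist l := by
  intro hs
  obtain ⟨-, -, -, -, -, -, -, hxt⟩ := sublist_split hs ht
  obtain ⟨r, -, hr, s, hrs, hs, u, hsu, hu, -⟩ := h.occurInOrder hs (by simp [hxt, hxt.symm])
  refine not_isSimple_a0_of_occursAt hs ?_ ((h.1.1 t).mp ht)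
  simp only [occursAt_x] at hr hu
  omega

theorem not_tcdc (h : InClass π l) {c d : Letter} (hcd : c ≠ d) (hcn : c ≠ .t n) :
    ¬ [.t n, c, d, c].Sublist l := by
  intro hs
  obtain ⟨q, -, hq, r, hqr, hr, s, hrs, -, u, hsu, hu, -⟩ :=
    h.occurInOrder hs (by simp [hcd, hcd.symm, hcn.symm])
  cases c <;> simp only [occursAt_x, occursAt_y, occursAt_z, occursAt_t] at hq hr hu <;> omega

theorem not_tcz (h : InClass π l) {c : Letter} (hct : c ≠ .t n) (hcz : c ≠ .z n) :
    ¬ [.t n, c, .z n].Sublist l := by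
  intro hs
  obtain ⟨q, -, hq, r, hqr, -, s, hrs, hs, -⟩ := h.occurInOrder hs (by simp [hct.symm, hcz])
  simp only [occursAt_z, occursAt_t] at hq hs
  omega

theorem congr {p s u v : List Letter} (h : InClass π (p ++ u ++ s))
    (huv : BetaRel (FreeMonoid.ofList u) (FreeMonoid.ofList v)) : InClass π (p ++ v ++ s) :=
  .trans (.mul (.mul (beta.refl (FreeMonoid.ofList p)) huv.symm)
    (beta.refl (FreeMonoid.ofList s))) h

theorem replicate_x {P Q : List Letter} {m n : ℕ} (hx : .x ∈ P ∨ .x ∈ Q) (hm : m ≠ 0)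
    (hn : n ≠ 0) (h : InClass π (P ++ List.replicate m .x ++ Q)) :
    InClass π (P ++ List.replicate n .x ++ Q) := by
  have hsep : ∀ t, (P ++ [Letter.x] ++ Q).count t = 1 →
      ¬ [.x, t, .x].Sublist (P ++ [.x] ++ Q) := by
    intro t ht hs
    have hxt : Letter.x ≠ t := by
      rintro rfl
      simp only [← List.count_pos_iff, List.count_append, List.count_singleton_self] at hx ht
      omega
    refine h.not_xtx ?_ (hs.trans ?_)
    · simpa [List.count_replicate, List.count_singleton, hxt] using ht
    · exact ((List.Sublist.refl P).append (List.singleton_sublist.mpr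
        (List.mem_replicate.mpr ⟨hm, rfl⟩))).append (List.Sublist.refl Q)
  exact (betaRel_replicate_of_mem hn hx hsep).symm.trans
    ((betaRel_replicate_of_mem hm hx hsep).trans h)

end InClass

/-! ### Substitutions into the `β`-class of `a0 k π` -/

section
variable {α : Type*}

theorem pair_sublist_or_pair_sublist_of_mem {a b : α} {l : List α} (ha : a ∈ l) (hb : b ∈ l)
    (hab : a ≠ b) : [a, b].Sublist l ∨ [b, a].Sublist l := by
  obtain ⟨l₁, l₂, rfl⟩ := List.append_of_mem ha
  rcases List.mem_append.mp hb with hb | hb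
  · exact .inr ((List.singleton_sublist.mpr hb).append (List.singleton_sublist.mpr (by simp)))
  · have hb₂ := (List.mem_cons.mp hb).resolve_left hab.symm
    exact .inl (.trans ((List.singleton_sublist.mpr hb₂).cons_cons a)
      (List.sublist_append_right _ _))

theorem exists_append_of_pair_sublist {a : α} {l : List α} (h : [a, a].Sublist l) :
    ∃ P Q R, l = P ++ [a] ++ Q ++ [a] ++ R := by
  obtain ⟨P, Q, rfl, h₁, h₂⟩ := List.cons_sublist_iff.mp h
  obtain ⟨P₁, P₂, rfl⟩ := List.append_of_mem h₁
  obtain ⟨Q₁, Q₂, rfl⟩ := List.append_of_mem (List.singleton_sublist.mp h₂)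
  exact ⟨P₁, P₂ ++ Q₁, Q₂, by simp⟩

theorem sublist_append_flatMap_append {A D X ds us : List α} {g : α → List α}
    (hs : us.Sublist X) (hg : List.Forall₂ (fun d u => d ∈ g u) ds us) :
    ds.Sublist (A ++ X.flatMap g ++ D) :=
  (sublist_flatMap_of_forall₂_mem hg hs).trans
    ((List.sublist_append_right _ _).trans (List.sublist_append_left _ _))

end

namespace InClass

section
variable {k : ℕ} {π : Equiv.Perm (Fin k)} {l : List Letter} {b c d : Letter}

theorem exists_eq_z_of_cdc (h : InClass π l) (hcd : c ≠ d) (hc : c ≠ .x)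
    (hs : [c, d, c].Sublist l) : ∃ n < k, c = .z n := by
  obtain ⟨r, -, hr, s, hrs, -, u, hsu, hu, -⟩ := h.occurInOrder hs (by simp [hcd, hcd.symm])
  cases c with
  | x => contradiction
  | y => simp only [occursAt_y] at hr hu; omega
  | z n => exact ⟨n, hr.1, rfl⟩
  | t => simp only [occursAt_t] at hr hu; omega

theorem exists_eq_z_of_cdcd (h : InClass π l) (hcd : c ≠ d) (hs : [c, d, c, d].Sublist l) :
    ∃ n < k, d = .z n ∧ c ≠ .t n := by
  have hdx : d ≠ .x := by
    rintro rfl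
    obtain ⟨q, -, hq, r, hqr, hr, s, hrs, hs, u, hsu, hu, -⟩ :=
      h.occurInOrder hs (by simp [hcd, hcd.symm])
    cases c <;> simp only [occursAt_x, occursAt_y, occursAt_z, occursAt_t] at hq hr hs hu <;> omega
  obtain ⟨n, hn, rfl⟩ :=
    h.exists_eq_z_of_cdc hcd.symm hdx ((List.sublist_cons_self c _).trans hs)
  refine ⟨n, hn, rfl, ?_⟩
  rintro rfl
  have := hs.count_le (.t n)
  simp [h.count_t hn] at this

theorem not_pair_sublist_twice {A U B D : List Letter} (h : InClass π (A ++ U ++ B ++ U ++ D))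
    (hcd : c ≠ d) : ¬ [c, d].Sublist U := by
  intro hs
  have hnil (l : List Letter) := List.nil_sublist l
  obtain ⟨n, hn, rfl, hct⟩ := h.exists_eq_z_of_cdcd hcd
    (((((hnil A).append hs).append (hnil B)).append hs).append (hnil D))
  have hc : [c].Sublist U := .trans (by simp) hs
  have hz : [Letter.z n].Sublist U := .trans (by simp) hs
  have htU : .t n ∉ U := by
    intro ht
    have hcount := h.count_t hn
    have := List.count_pos_iff.mpr ht
    simp only [List.count_append] at hcount
    omega
  have ht := h.t_mem hn
  simp only [List.mem_append, htU, or_false] at ht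
  rcases ht with (ht | ht) | ht <;> replace ht := List.singleton_sublist.mpr ht
  · exact h.not_tcdc hcd hct ((((ht.append hs).append (hnil B)).append hc).append (hnil D))
  · exact h.not_tcz hct hcd (((((hnil A).append (hnil U)).append ht).append hs).append (hnil D))
  · exact h.not_zzt hn (((((hnil A).append hz).append (hnil B)).append hz).append ht)

theorem eq_of_mem_twice {A U B D : List Letter} (h : InClass π (A ++ U ++ B ++ U ++ D))
    (hc : c ∈ U) (hd : d ∈ U) : c = d := by
  by_contra hcd
  rcases pair_sublist_or_pair_sublist_of_mem hc hd hcd with hs | hs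
  · exact h.not_pair_sublist_twice hcd hs
  · exact h.not_pair_sublist_twice (Ne.symm hcd) hs

theorem not_xcxdx (h : InClass π l) (hc : c ≠ .x) (hd : d ≠ .x) :
    ¬ [.x, c, .x, d, .x].Sublist l := by
  intro hs
  obtain ⟨p, -, hp, q, hpq, -, r, hqr, hr, s, hrs, -, u, hsu, hu, -⟩ :=
    h.occurInOrder hs (by simp [hc, hc.symm, hd, hd.symm])
  simp only [occursAt_x] at hp hr hu
  omega

/-- The letters between the two places of `x` cannot be spread over two gaps between powers of
`x`. -/
theorem mem_of_occurInOrder_xbx {A M E : List Letter} (h : InClass π (A ++ (M ++ E)))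
    (hM : [.x, d, .x].Sublist M) (hd : d ≠ .x) (hb : OccurInOrder (OccursAt π) 0 [.x, b, .x])
    (hbx : b ≠ .x) : b ∈ M := by
  by_contra hbM
  have hnil (l : List Letter) := List.nil_sublist l
  have not_xb : ¬ [.x, b].Sublist A := fun hs =>
    h.not_xcxdx hbx hd (hs.append (hM.append (hnil E)))
  have not_bx : ¬ [b, .x].Sublist (M ++ E) := by
    intro hs
    rcases sublist_two hs with hs | ⟨hb, -⟩ | hs
    · exact hbM (hs.subset (by simp))
    · exact hbM hb
    · exact h.not_xcxdx hd hbx ((hnil A).append (hM.append hs))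
  rcases sublist_three (h.sublist hb (by simp [hbx, hbx.symm])) with hs | ⟨hs, -⟩ | ⟨-, hs⟩ | hs
  · exact not_xb (.trans (by simp) hs)
  · exact not_xb hs
  · exact not_bx hs
  · exact not_bx (.trans (by simp) hs)

end

section
variable {k : ℕ} {π : Equiv.Perm (Fin k)} {g : Letter → List Letter} {A D X B T : List Letter}
  {u b c d e : Letter}

theorem eq_of_mem (h : InClass π (A ++ X.flatMap g ++ D)) (hu : [u, u].Sublist X) (hc : c ∈ g u)
    (hd : d ∈ g u) : c = d := by
  obtain ⟨P, Q, R, rfl⟩ := exists_append_of_pair_sublist hu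
  refine InClass.eq_of_mem_twice (π := π) (A := A ++ P.flatMap g) (B := Q.flatMap g) (U := g u)
    (D := R.flatMap g ++ D) ?_ hc hd
  simpa using h

theorem t_notMem (h : InClass π (A ++ X.flatMap g ++ D)) (hu : [u, u].Sublist X) {n : ℕ}
    (hn : n < k) : .t n ∉ g u := by
  intro ht
  have hle := (sublist_append_flatMap_append (A := A) (D := D) hu
    (.cons ht (.cons ht .nil))).count_le (.t n)
  rw [h.count_t hn] at hle
  simp at hle

theorem eq_x_of_enclosed (h : InClass π (A ++ (u :: B ++ u :: T).flatMap g ++ D))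
    (hB : ∀ e ∈ B, [e, e].Sublist (u :: B ++ u :: T)) (hc : c ∈ g u) (he : e ∈ B)
    (hd : d ∈ g e) (hcd : c ≠ d) : c = .x := by
  have hueu : [u, e, u].Sublist (u :: B ++ u :: T) :=
    ((List.singleton_sublist.mpr he).cons_cons u).append (List.singleton_sublist.mpr (by simp))
  by_contra hcx
  obtain ⟨n, hn, rfl⟩ := h.exists_eq_z_of_cdc hcd hcx
    (sublist_append_flatMap_append hueu (.cons hc (.cons hd (.cons hc .nil))))
  have huu : [u, u].Sublist (u :: B ++ u :: T) := .trans (by simp) hueu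
  have htu := h.t_notMem huu hn
  have htB : .t n ∉ B.flatMap g := by
    rw [List.mem_flatMap]
    rintro ⟨e, he, ht⟩
    exact h.t_notMem (hB e he) hn ht
  have hassoc : A ++ (u :: B ++ u :: T).flatMap g ++ D =
      A ++ (g u ++ (B.flatMap g ++ (g u ++ (T.flatMap g ++ D)))) := by simp
  rw [hassoc] at h
  have hz := List.singleton_sublist.mpr hc
  have hd := List.singleton_sublist.mpr (List.mem_flatMap.mpr ⟨e, he, hd⟩)
  have hnil (l : List Letter) := List.nil_sublist l
  have ht := h.t_mem hn
  rw [List.mem_append, List.mem_append, List.mem_append, List.mem_append, or_iff_right htu,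
    or_iff_right htB, or_iff_right htu] at ht
  rcases ht with ht | ht <;> replace ht := List.singleton_sublist.mpr ht
  · exact h.not_tcdc hcd Letter.noConfusion
      (ht.append (hz.append (hd.append (hz.append (hnil _)))))
  · exact h.not_zzt hn ((hnil A).append (hz.append ((hnil _).append (hz.append ht))))

theorem exists_mem_block_of_occurInOrder
    (h : InClass π (A ++ (u :: B ++ u :: T).flatMap g ++ D)) (hx : .x ∈ g u) (he : e ∈ B)
    (hd : d ∈ g e) (hdx : d ≠ .x) (hu : ∀ c ∈ g u, c = .x)
    (hb : OccurInOrder (OccursAt π) 0 [.x, b, .x]) (hbx : b ≠ .x) : ∃ v ∈ B, b ∈ g v := by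
  have hM : [.x, d, .x].Sublist (g u ++ B.flatMap g ++ g u) :=
    ((List.singleton_sublist.mpr hx).append
      (List.singleton_sublist.mpr (List.mem_flatMap.mpr ⟨e, he, hd⟩))).append
        (List.singleton_sublist.mpr hx)
  have hbM : b ∈ g u ++ B.flatMap g ++ g u :=
    mem_of_occurInOrder_xbx (A := A) (E := T.flatMap g ++ D) (by simpa using h) hM hdx hb hbx
  have hbu : b ∉ g u := fun hb => hbx (hu b hb)
  simpa only [List.mem_append, hbu, or_false, false_or, List.mem_flatMap] using hbM

end

end InClass

/-! ### The words of the identities -/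

section
variable (m : ℕ) (π : Equiv.Perm (Fin (m + 2)))

/-- The three letters `firstLetter m i`, `i < 3`, take the place of the first `z`-letter in the
block of `a0 (m + 2) π`. -/
abbrev firstLetter (i : ℕ) : Letter := .z (m + 2 + i)

/-- The three letters `lastLetter m i`, `i < 3`, take the place of the last `z`-letter in the
block of `a0 (m + 2) π`. -/
abbrev lastLetter (i : ℕ) : Letter := .z (m + 5 + i)

/-- The part of the block of `a0 (m + 2) π` between its first and its last `z`-letter. -/
def blockCore : List Letter :=
  .y 0 :: .y 0 :: (List.ofFn fun i : Fin m =>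
    [Letter.z (π i.castSucc.succ), .y (i + 1), .y (i + 1)]).flatten

/-- The letters `firstLetter m i` in the block, with an `x` inserted after the first if `p`. -/
def firstGroup (p : Bool) : List Letter :=
  firstLetter m 0 :: ((if p then [.x] else []) ++ [firstLetter m 1, firstLetter m 2])

/-- The letters `lastLetter m i` in the block, with an `x` inserted before the last if `q`. -/
def lastGroup (q : Bool) : List Letter :=
  [lastLetter m 0, lastLetter m 1] ++ ((if q then [.x] else []) ++ [lastLetter m 2])

/-- The part between the two outer occurrences of `x` in the words of the identities. -/
def identityBlock (p q : Bool) : List Letter := firstGroup m p ++ blockCore m π ++ lastGroup m q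

/-- The factor that replaces `t_i z_i` in the words of the identities. The order of the letters
differs from the order in the block, so that the block can be recovered from images of three
letters. -/
def tailFactor (i : Fin (m + 2)) : List Letter :=
  if i = π 0 then [.t (m + 2), firstLetter m 0, .t (m + 2 + 2), firstLetter m 2,
    .t (m + 2 + 1), firstLetter m 1]
  else if i = π (Fin.last _) then [.t (m + 5 + 1), lastLetter m 1, .t (m + 5), lastLetter m 0,
    .t (m + 5 + 2), lastLetter m 2]
  else [.t i, .z i]

/-- The part after the last `x` in the words of the identities. -/
def identityTail : List Letter := (List.ofFn (tailFactor m π)).flatten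

/-- The words of the identities, as lists of letters: `a0 (m + 2) π` with the first and the last
`z`-letter of the block tripled, and with an additional `x` next to them if `p`, respectively
if `q`. -/
def identityWord (p q : Bool) : List Letter :=
  .x :: identityBlock m π p q ++ .x :: identityTail m π

end

section
variable {m : ℕ} {π : Equiv.Perm (Fin (m + 2))} {p q : Bool}

theorem z_cons_blockCore : Letter.z (π 0) :: blockCore m π =
    (List.ofFn fun i : Fin (m + 1) => [Letter.z (π i.castSucc), .y i, .y i]).flatten := by
  rw [List.ofFn_succ]
  simp [blockCore]

theorem toList_a0 : (a0 (m + 2) π).toList = .x :: .z (π 0) :: blockCore m π ++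
    .z (π (Fin.last _)) ::
      .x :: (List.ofFn fun i : Fin (m + 2) => [Letter.t i, .z i]).flatten := by
  rw [List.cons_append, z_cons_blockCore]
  simp only [a0, FreeMonoid.toList_mul, FreeMonoid.toList_of, FreeMonoid.toList_prod,
    List.map_ofFn, List.append_assoc]
  rw [List.ofFn_succ' (n := m + 1)]
  simp [pow_two, Function.comp_def]

theorem mem_blockCore {u : Letter} (h : u ∈ blockCore m π) :
    (∃ j ≤ m, u = .y j) ∨ ∃ i : Fin m, u = .z (π i.castSucc.succ) := by
  simp only [blockCore, List.mem_cons, List.mem_flatten, List.mem_ofFn, exists_exists_eq_and,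
    List.not_mem_nil, or_false, or_self] at h
  rcases h with h | h | ⟨i, h | h⟩
  · exact .inl ⟨0, m.zero_le, h⟩
  · exact .inl ⟨0, m.zero_le, h⟩
  · exact .inr ⟨i, h⟩
  · exact .inl ⟨i + 1, i.2, h⟩

theorem mem_firstGroup {u : Letter} (h : u ∈ firstGroup m p) :
    u = .x ∨ ∃ i < 3, u = firstLetter m i := by
  have h : u = .x ∨ u = firstLetter m 0 ∨ u = firstLetter m 1 ∨ u = firstLetter m 2 := by
    cases p <;> simp [firstGroup] at h <;> tauto
  rcases h with h | h | h | h
  exacts [.inl h, .inr ⟨0, by simp, h⟩, .inr ⟨1, by simp, h⟩, .inr ⟨2, by simp, h⟩]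

theorem mem_lastGroup {u : Letter} (h : u ∈ lastGroup m q) :
    u = .x ∨ ∃ i < 3, u = lastLetter m i := by
  have h : u = .x ∨ u = lastLetter m 0 ∨ u = lastLetter m 1 ∨ u = lastLetter m 2 := by
    cases q <;> simp [lastGroup] at h <;> tauto
  rcases h with h | h | h | h
  exacts [.inl h, .inr ⟨0, by simp, h⟩, .inr ⟨1, by simp, h⟩, .inr ⟨2, by simp, h⟩]

theorem mem_identityBlock {u : Letter} (h : u ∈ identityBlock m π p q) :
    u = .x ∨ (∃ i < 3, u = firstLetter m i) ∨ (∃ j ≤ m, u = .y j) ∨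
      (∃ i : Fin m, u = .z (π i.castSucc.succ)) ∨ ∃ i < 3, u = lastLetter m i := by
  rcases List.mem_append.mp h with h | h
  · rcases List.mem_append.mp h with h | h
    · exact (mem_firstGroup h).imp_right .inl
    · exact .inr (.inr ((mem_blockCore h).imp_right .inl))
  · exact (mem_lastGroup h).imp_right fun h => .inr (.inr (.inr h))

theorem sublist_blockCore_of_sublist_cons {l : List Letter}
    (h : l.Sublist (.z (π 0) :: blockCore m π)) (hl : ∀ r, l ≠ .z (π 0) :: r) :
    l.Sublist (blockCore m π) := by
  rcases List.sublist_cons_iff.mp h with h | ⟨r, hr, -⟩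
  · exact h
  · exact absurd hr (hl r)

theorem yy_sublist_blockCore {i j : ℕ} (hij : i ≤ j) (hj : j ≤ m) :
    [.y i, .y j].Sublist (blockCore m π) := by
  refine sublist_blockCore_of_sublist_cons ?_ (by simp)
  rw [z_cons_blockCore]
  obtain rfl | hij := hij.eq_or_lt
  · exact .trans (by simp) (List.sublist_flatten_of_mem
      (List.mem_ofFn.mpr ⟨⟨i, Nat.lt_succ_of_le hj⟩, rfl⟩))
  · exact pair_sublist_flatten_ofFn (i := ⟨i, by omega⟩) (j := ⟨j, by omega⟩) hij (by simp)
      (by simp)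

theorem yzy_sublist_blockCore (i : Fin m) :
    [.y 0, .z (π i.castSucc.succ), .y m].Sublist (blockCore m π) := by
  have h : [Letter.z (π i.castSucc.succ), .y m].Sublist (Letter.z (π 0) :: blockCore m π) := by
    rw [z_cons_blockCore]
    have := i.2
    rcases Nat.lt_or_ge (i + 1) m with hi | hi
    · exact pair_sublist_flatten_ofFn (i := i.succ) (j := Fin.last m) hi (by simp) (by simp)
    · have hm : m = i + 1 := by omega
      exact .trans (by simp [← hm]) (List.sublist_flatten_of_mem
        (List.mem_ofFn.mpr ⟨i.succ, rfl⟩))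
  replace h := sublist_blockCore_of_sublist_cons h (by simp [Fin.val_inj])
  rw [blockCore] at h ⊢
  simp only [List.sublist_cons_iff (a := Letter.y 0)] at h
  exact List.Sublist.cons_cons _ (by simpa [List.sublist_cons_iff] using h)

theorem z_mem_identityTail (i : Fin m) : .z (π i.castSucc.succ) ∈ identityTail m π := by
  refine List.mem_flatten.mpr ⟨_, List.mem_ofFn.mpr ⟨π i.castSucc.succ, rfl⟩, ?_⟩
  have hfirst : i.castSucc.succ ≠ 0 := Fin.succ_ne_zero _
  have hlast : i.castSucc.succ ≠ Fin.last (m + 1) := by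
    rw [Fin.succ_castSucc]
    exact (Fin.castSucc_lt_last _).ne
  simp [tailFactor, π.injective.eq_iff, hfirst, hlast]

theorem firstLetters_sublist_identityTail :
    [firstLetter m 0, firstLetter m 2, firstLetter m 1].Sublist (identityTail m π) := by
  refine .trans ?_ (List.sublist_flatten_of_mem (List.mem_ofFn.mpr ⟨π 0, rfl⟩))
  simp [tailFactor, List.sublist_cons_iff]

theorem lastLetters_sublist_identityTail :
    [lastLetter m 1, lastLetter m 0, lastLetter m 2].Sublist (identityTail m π) := by
  refine .trans ?_ (List.sublist_flatten_of_mem (List.mem_ofFn.mpr ⟨π (Fin.last _), rfl⟩))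
  have : Fin.last (m + 1) ≠ 0 := Fin.last_pos.ne'
  simp [tailFactor, this, List.sublist_cons_iff]

theorem firstLetters_sublist_firstGroup :
    [firstLetter m 0, firstLetter m 1, firstLetter m 2].Sublist (firstGroup m p) := by
  cases p <;> simp [firstGroup, List.sublist_cons_iff]

theorem lastLetters_sublist_lastGroup :
    [lastLetter m 0, lastLetter m 1, lastLetter m 2].Sublist (lastGroup m q) := by
  cases q <;> simp [lastGroup, List.sublist_cons_iff]

theorem x_append_x_append_sublist_identityWord {l r : List Letter}
    (hl : l.Sublist (identityBlock m π p q)) (hr : r.Sublist (identityTail m π)) :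
    (.x :: l ++ .x :: r).Sublist (identityWord m π p q) :=
  (hl.cons_cons _).append (hr.cons_cons _)

theorem append_sublist_identityWord {l r : List Letter} (hl : l.Sublist (identityBlock m π p q))
    (hr : r.Sublist (identityTail m π)) : (l ++ r).Sublist (identityWord m π p q) :=
  List.Sublist.append (hl.cons _) (hr.cons _)

theorem append_sublist_identityBlock {l a b : List Letter} (ha : a.Sublist (firstGroup m p))
    (hl : l.Sublist (blockCore m π)) (hb : b.Sublist (lastGroup m q)) :
    (a ++ l ++ b).Sublist (identityBlock m π p q) :=
  (ha.append hl).append hb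

theorem map_firstLetter_sublist_identityWord {l : List ℕ} (h : l.Sublist [0, 1, 2, 0, 2, 1]) :
    (l.map (firstLetter m)).Sublist (identityWord m π p q) :=
  (h.map _).trans (append_sublist_identityWord (l := [_, _, _])
    (append_sublist_identityBlock firstLetters_sublist_firstGroup (List.nil_sublist _)
      (List.nil_sublist _)) firstLetters_sublist_identityTail)

theorem map_lastLetter_sublist_identityWord {l : List ℕ} (h : l.Sublist [0, 1, 2, 1, 0, 2]) :
    (l.map (lastLetter m)).Sublist (identityWord m π p q) :=
  (h.map _).trans (append_sublist_identityWord (l := [_, _, _])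
    (append_sublist_identityBlock (List.nil_sublist _) (List.nil_sublist _)
      lastLetters_sublist_lastGroup) lastLetters_sublist_identityTail)

theorem mem_identityTail_of_mem_identityBlock {u : Letter} (h : u ∈ identityBlock m π p q)
    (hx : u ≠ .x) (hy : ∀ j ≤ m, u ≠ .y j) : u ∈ identityTail m π := by
  rcases mem_identityBlock h with h | ⟨i, hi, rfl⟩ | ⟨j, hj, h⟩ | ⟨i, rfl⟩ | ⟨i, hi, rfl⟩
  · exact absurd h hx
  · exact firstLetters_sublist_identityTail.subset (by interval_cases i <;> simp)
  · exact absurd h (hy j hj)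
  · exact z_mem_identityTail i
  · exact lastLetters_sublist_identityTail.subset (by interval_cases i <;> simp)

theorem pair_sublist_identityWord {u : Letter} (h : u ∈ identityBlock m π p q ∨ u = .x) :
    [u, u].Sublist (identityWord m π p q) := by
  by_cases hx : u = .x
  · subst hx
    exact x_append_x_append_sublist_identityWord (List.nil_sublist _) (List.nil_sublist _)
  replace h := h.resolve_right hx
  by_cases hy : ∃ j ≤ m, u = .y j
  · obtain ⟨j, hj, rfl⟩ := hy
    exact append_sublist_identityWord (append_sublist_identityBlock (List.nil_sublist _)
      (yy_sublist_blockCore le_rfl hj) (List.nil_sublist _)) (List.nil_sublist _)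
  · push Not at hy
    exact append_sublist_identityWord (l := [_]) (List.singleton_sublist.mpr h)
      (List.singleton_sublist.mpr (mem_identityTail_of_mem_identityBlock h hx hy))

end

/-! ### Substitutions that map a word of the identities into the β-class -/

section
variable {m : ℕ} {π : Equiv.Perm (Fin (m + 2))} {p q : Bool} {g : Letter → List Letter}
  {A D : List Letter}

/-- The substitution `g` maps the block of the words of the identities, together with the two `x`
around it, to a power of a letter, or erases `x`. -/
def CollapsesBlock (π : Equiv.Perm (Fin (m + 2))) (g : Letter → List Letter) : Prop :=
  g .x = [] ∨ ∃ c ∈ g .x, ∀ u ∈ identityBlock m π true true, ∀ d ∈ g u, d = c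

/-- The substitution `g` maps the block of `identityWord m π p q` onto the block of
`a0 (m + 2) π`: the `z`-letters of the latter all have preimages, and the tripled letters that
precede the preimage of the first one or follow the preimage of the last one are mapped to powers
of `x`. -/
structure SpansBlock (π : Equiv.Perm (Fin (m + 2))) (p q : Bool) (g : Letter → List Letter) :
    Prop where
  x_mem : .x ∈ g .x
  eq_x : ∀ c ∈ g .x, c = .x
  y_mem : .y 0 ∈ g (.y 0)
  exists_z_mem : ∀ i, ∃ u ∈ identityBlock m π p q, .z (π i) ∈ g u
  exists_firstLetter : ∃ i < 3, .z (π 0) ∈ g (firstLetter m i) ∧ (p = true → i ≠ 0) ∧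
    (i ≠ 0 → ∀ d ∈ g (firstLetter m 0), d = .x)
  exists_lastLetter : ∃ i < 3, .z (π (Fin.last _)) ∈ g (lastLetter m i) ∧ (q = true → i ≠ 2) ∧
    (i ≠ 2 → ∀ d ∈ g (lastLetter m 2), d = .x)

theorem mem_identityBlock_true_of_mem {u : Letter} (h : u ∈ identityBlock m π p q ∨ u = .x) :
    u ∈ identityBlock m π true true := by
  cases p <;> cases q <;> simp [identityBlock, firstGroup, lastGroup] at h ⊢ <;> tauto

theorem mem_or_eq_x_of_mem_identityBlock_true {u : Letter}
    (h : u ∈ identityBlock m π true true) : u ∈ identityBlock m π p q ∨ u = .x := by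
  cases p <;> cases q <;> simp [identityBlock, firstGroup, lastGroup] at h ⊢ <;> tauto

theorem sublist_identityWord {l : List Letter} (hl : l.Sublist (identityBlock m π p q)) :
    l.Sublist (identityWord m π p q) := by
  simpa using append_sublist_identityWord hl (List.nil_sublist (identityTail m π))

theorem x_append_x_sublist_identityWord {l : List Letter}
    (hl : l.Sublist (identityBlock m π p q)) :
    (Letter.x :: l ++ [Letter.x]).Sublist (identityWord m π p q) :=
  x_append_x_append_sublist_identityWord hl (List.nil_sublist _)

theorem sublist_identityBlock {l : List Letter} (hl : l.Sublist (blockCore m π)) :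
    l.Sublist (identityBlock m π p q) := by
  simpa using append_sublist_identityBlock (p := p) (q := q) (List.nil_sublist _) hl
    (List.nil_sublist _)

theorem y_sublist_blockCore {j : ℕ} (hj : j ≤ m) : [.y j].Sublist (blockCore m π) :=
  .trans (List.sublist_cons_self _ _) (yy_sublist_blockCore le_rfl hj)

theorem flatMap_eq_replicate {α β : Type*} {g : α → List β} {l : List α} {c : β}
    (h : ∀ u ∈ l, ∀ d ∈ g u, d = c) : l.flatMap g = List.replicate (l.flatMap g).length c :=
  List.eq_replicate_of_mem fun d hd =>
    let ⟨u, hu, hd⟩ := List.mem_flatMap.mp hd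
    h u hu d hd

namespace InClass

theorem congr_of_collapsesBlock (h : InClass π (A ++ (identityWord m π p q).flatMap g ++ D))
    (hg : CollapsesBlock π g) (p' q' : Bool) :
    InClass π (A ++ (identityWord m π p' q').flatMap g ++ D) := by
  rcases hg with hx | ⟨c, hc, hu⟩
  · have hword (p q : Bool) :
        (identityWord m π p q).flatMap g = (identityWord m π false false).flatMap g := by
      cases p <;> cases q <;> simp [identityWord, identityBlock, firstGroup, lastGroup, hx]
    rwa [hword, ← hword p q]
  · have hword (p q : Bool) : ∃ N ≥ 2, (identityWord m π p q).flatMap g =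
        List.replicate N c ++ (identityTail m π).flatMap g := by
      have hc2 : [c, c].Sublist ((Letter.x :: identityBlock m π p q ++ [Letter.x]).flatMap g) := by
        simpa using (List.singleton_sublist.mpr hc).append
          ((List.singleton_sublist.mpr hc).trans (List.sublist_append_right _ _))
      refine ⟨_, hc2.length_le, ?_⟩
      rw [← flatMap_eq_replicate fun u hu' => hu u (mem_identityBlock_true_of_mem (p := p)
        (q := q) (by simpa [or_comm] using hu'))]
      simp [identityWord]
    obtain ⟨N, hN, hword₁⟩ := hword p q
    obtain ⟨N', hN', hword₂⟩ := hword p' q'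
    rw [hword₁, ← List.append_assoc, List.append_assoc _ _ D] at h
    rw [hword₂, ← List.append_assoc, List.append_assoc _ _ D]
    exact h.congr (betaRel_replicate c hN hN')

theorem congr_of_eq_x {P Q M M' : List Letter} (h : InClass π (A ++ (P ++ M ++ Q).flatMap g ++ D))
    (hxg : .x ∈ g .x) (hPQ : .x ∈ P ∨ .x ∈ Q) (hM : .x ∈ M) (hgM : ∀ u ∈ M, ∀ d ∈ g u, d = .x)
    (hM' : .x ∈ M') (hgM' : ∀ u ∈ M', ∀ d ∈ g u, d = .x) :
    InClass π (A ++ (P ++ M' ++ Q).flatMap g ++ D) := by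
  have hx {l : List Letter} (hl : .x ∈ l) : .x ∈ l.flatMap g := List.mem_flatMap.mpr ⟨_, hl, hxg⟩
  have hassoc (N : List Letter) : A ++ (P ++ N ++ Q).flatMap g ++ D =
      (A ++ P.flatMap g) ++ N.flatMap g ++ (Q.flatMap g ++ D) := by simp
  rw [hassoc, flatMap_eq_replicate hgM] at h
  rw [hassoc, flatMap_eq_replicate hgM']
  exact h.replicate_x (hPQ.imp (fun hP => List.mem_append_right _ (hx hP))
    fun hQ => List.mem_append_left _ (hx hQ)) (List.length_pos_of_mem (hx hM)).ne'
    (List.length_pos_of_mem (hx hM')).ne'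

theorem congr_firstGroup (h : InClass π (A ++ (identityWord m π p q).flatMap g ++ D))
    (hx : .x ∈ g .x) (hgx : ∀ c ∈ g .x, c = .x) (hf : ∀ d ∈ g (firstLetter m 0), d = .x)
    (p' : Bool) : InClass π (A ++ (identityWord m π p' q).flatMap g ++ D) := by
  let M (p : Bool) : List Letter := .x :: firstLetter m 0 :: if p then [.x] else []
  have hword (p : Bool) : identityWord m π p q = [] ++ M p ++ ([firstLetter m 1, firstLetter m 2] ++
      blockCore m π ++ lastGroup m q ++ .x :: identityTail m π) := by
    cases p <;> simp [M, identityWord, identityBlock, firstGroup]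
  have hgM (p : Bool) : ∀ u ∈ M p, ∀ d ∈ g u, d = .x := by
    cases p <;> simp [M] <;> tauto
  rw [hword] at h ⊢
  exact h.congr_of_eq_x hx (.inr (by simp)) List.mem_cons_self (hgM p) List.mem_cons_self (hgM p')

theorem congr_lastGroup (h : InClass π (A ++ (identityWord m π p q).flatMap g ++ D))
    (hx : .x ∈ g .x) (hgx : ∀ c ∈ g .x, c = .x) (hl : ∀ d ∈ g (lastLetter m 2), d = .x)
    (q' : Bool) : InClass π (A ++ (identityWord m π p q').flatMap g ++ D) := by
  let M (q : Bool) : List Letter := (if q then [.x] else []) ++ [lastLetter m 2, .x]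
  have hword (q : Bool) : identityWord m π p q = (.x :: firstGroup m p ++ blockCore m π ++
      [lastLetter m 0, lastLetter m 1]) ++ M q ++ identityTail m π := by
    cases q <;> simp [M, identityWord, identityBlock, lastGroup]
  have hgM (q : Bool) : ∀ u ∈ M q, ∀ d ∈ g u, d = .x := by
    cases q <;> simp [M] <;> tauto
  rw [hword] at h ⊢
  exact h.congr_of_eq_x hx (.inl (by simp)) (by simp [M]) (hgM q) (by simp [M]) (hgM q')

theorem exists_y_mem (h : InClass π (A ++ (identityWord m π p q).flatMap g ++ D))
    (hx : .x ∈ g .x) (hgx : ∀ c ∈ g .x, c = .x) {d e : Letter} (he : e ∈ identityBlock m π p q)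
    (hd : d ∈ g e) (hdx : d ≠ .x) (i : Fin (m + 1)) : ∃ j : Fin (m + 1), .y i ∈ g (.y j) := by
  obtain ⟨v, hv, hi⟩ := h.exists_mem_block_of_occurInOrder hx he hd hdx hgx (b := .y i)
    ⟨0, le_rfl, .inl rfl, _, by omega, ⟨by omega, .inl rfl⟩, _, by omega, .inr rfl, trivial⟩
    (by simp)
  have hvx : v ≠ .x := by
    rintro rfl
    exact absurd (hgx _ hi) (by simp)
  by_contra! hy
  have hs := x_append_x_append_sublist_identityWord (List.singleton_sublist.mpr he)
    (List.singleton_sublist.mpr (mem_identityTail_of_mem_identityBlock hv hvx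
      fun j hj hvj => hy ⟨j, Nat.lt_succ_of_le hj⟩ (hvj ▸ hi)))
  obtain ⟨r₁, -, h₁, r₂, h₁₂, -, r₃, h₂₃, h₃, r₄, h₃₄, h₄, -⟩ := h.occurInOrder
    (sublist_append_flatMap_append hs (.cons hx (.cons hd (.cons hx (.cons hi .nil)))))
    (by simp [hdx, hdx.symm])
  simp only [occursAt_x, occursAt_y] at h₁ h₃ h₄
  omega

theorem y_mem (h : InClass π (A ++ (identityWord m π p q).flatMap g ++ D))
    (hx : .x ∈ g .x) (hgx : ∀ c ∈ g .x, c = .x) {d e : Letter} (he : e ∈ identityBlock m π p q)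
    (hd : d ∈ g e) (hdx : d ≠ .x) {n : ℕ} (hn : n ≤ m) : .y n ∈ g (.y n) := by
  choose f hf using h.exists_y_mem hx hgx he hd hdx
  have hs {i j : Fin (m + 1)} (hij : f i ≤ f j) : [.y (f i), .y (f j)].Sublist
      (identityWord m π p q) :=
    sublist_identityWord (sublist_identityBlock (yy_sublist_blockCore hij (by omega)))
  have hmono : StrictMono f := by
    intro i j hij
    by_contra! hji
    obtain ⟨r₁, -, h₁, r₂, h₁₂, h₂, -⟩ := h.occurInOrder
      (sublist_append_flatMap_append (hs hji) (.cons (hf j) (.cons (hf i) .nil)))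
      (by simp; omega)
    simp only [occursAt_y] at h₁ h₂
    omega
  have hid : f ⟨n, by omega⟩ = ⟨n, by omega⟩ := le_antisymm hmono.apply_le hmono.le_apply
  simpa only [hid] using hf ⟨n, by omega⟩

theorem z_notMem_y (h : InClass π (A ++ (identityWord m π p q).flatMap g ++ D))
    (hx : .x ∈ g .x) {j n : ℕ} (hj : j ≤ m) (hn : n < m + 2) : .z n ∉ g (.y j) := by
  intro hz
  have hs := x_append_x_sublist_identityWord (p := p) (q := q)
    (sublist_identityBlock (π := π) (yy_sublist_blockCore le_rfl hj))
  exact h.not_zzx hn (.trans (List.sublist_cons_self .x _)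
    (sublist_append_flatMap_append hs (.cons hx (.cons hz (.cons hz (.cons hx .nil))))))

theorem exists_eq_firstLetter (h : InClass π (A ++ (identityWord m π p q).flatMap g ++ D))
    (hx : .x ∈ g .x) (hgx : ∀ c ∈ g .x, c = .x) (hy : .y 0 ∈ g (.y 0)) {u : Letter}
    (hu : u ∈ identityBlock m π p q) (hz : .z (π 0) ∈ g u) : ∃ i < 3, u = firstLetter m i := by
  have hπ : blockIndex π (π 0) = 0 := blockIndex_apply π 0
  have hs (hs : [.y 0, u].Sublist (identityBlock m π p q)) : False := by
    obtain ⟨r₁, -, h₁, r₂, h₁₂, h₂, r₃, h₂₃, h₃, -⟩ := h.occurInOrder (ls := [.y 0, .z (π 0), .x])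
      (.trans (List.sublist_cons_self .x _) (sublist_append_flatMap_append
        (x_append_x_sublist_identityWord hs) (.cons hx (.cons hy (.cons hz (.cons hx .nil))))))
      (by simp)
    simp only [occursAt_x, occursAt_y, occursAt_z, hπ] at h₁ h₂ h₃
    omega
  rcases mem_identityBlock hu with rfl | hu | ⟨j, hj, rfl⟩ | ⟨i, rfl⟩ | ⟨i, hi, rfl⟩
  · exact absurd (hgx _ hz) (by simp)
  · exact hu
  · exact absurd hz (h.z_notMem_y hx hj (π 0).2)
  · exact (hs (sublist_identityBlock (.trans (by simp) (yzy_sublist_blockCore i)))).elim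
  · refine (hs (append_sublist_identityBlock (List.nil_sublist _) (y_sublist_blockCore m.zero_le)
      (.trans (List.singleton_sublist.mpr ?_) lastLetters_sublist_lastGroup))).elim
    interval_cases i <;> simp

theorem exists_eq_lastLetter (h : InClass π (A ++ (identityWord m π p q).flatMap g ++ D))
    (hx : .x ∈ g .x) (hgx : ∀ c ∈ g .x, c = .x) (hy : .y m ∈ g (.y m)) {u : Letter}
    (hu : u ∈ identityBlock m π p q) (hz : .z (π (Fin.last _)) ∈ g u) :
    ∃ i < 3, u = lastLetter m i := by
  have hπ : blockIndex π (π (Fin.last _)) = m + 1 := blockIndex_apply π (Fin.last _)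
  have hs (hs : [u, .y m].Sublist (identityBlock m π p q)) : False := by
    obtain ⟨r₁, -, h₁, r₂, h₁₂, h₂, -⟩ := h.occurInOrder (sublist_append_flatMap_append
      (sublist_identityWord hs) (.cons hz (.cons hy .nil))) (by simp)
    simp only [occursAt_y, occursAt_z, hπ] at h₁ h₂
    omega
  rcases mem_identityBlock hu with rfl | ⟨i, hi, rfl⟩ | ⟨j, hj, rfl⟩ | ⟨i, rfl⟩ | hu
  · exact absurd (hgx _ hz) (by simp)
  · refine (hs (append_sublist_identityBlock (a := [_])
      (.trans (List.singleton_sublist.mpr ?_) firstLetters_sublist_firstGroup)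
      (y_sublist_blockCore le_rfl) (List.nil_sublist _))).elim
    interval_cases i <;> simp
  · exact absurd hz (h.z_notMem_y hx hj (π (Fin.last _)).2)
  · exact (hs (sublist_identityBlock (.trans (by simp) (yzy_sublist_blockCore i)))).elim
  · exact hu

theorem z_notMem_firstLetter (h : InClass π (A ++ (identityWord m π true q).flatMap g ++ D))
    (hx : .x ∈ g .x) (hy : .y 0 ∈ g (.y 0)) : .z (π 0) ∉ g (firstLetter m 0) := by
  intro hz
  have hs : [.x, firstLetter m 0, .x, .y 0].Sublist (identityWord m π true q) := by
    refine List.Sublist.cons_cons _ (.trans ?_ (List.sublist_append_left _ _))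
    exact append_sublist_identityBlock (a := [firstLetter m 0, .x]) (by simp [firstGroup])
      (y_sublist_blockCore m.zero_le) (List.nil_sublist _)
  obtain ⟨r₁, -, h₁, r₂, h₁₂, -, r₃, h₂₃, h₃, r₄, h₃₄, h₄, -⟩ := h.occurInOrder
    (sublist_append_flatMap_append hs (.cons hx (.cons hz (.cons hx (.cons hy .nil))))) (by simp)
  simp only [occursAt_x, occursAt_y] at h₁ h₃ h₄
  omega

theorem z_notMem_lastLetter (h : InClass π (A ++ (identityWord m π p true).flatMap g ++ D))
    (hx : .x ∈ g .x) (hy : .y 0 ∈ g (.y 0)) : .z (π (Fin.last _)) ∉ g (lastLetter m 2) := by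
  intro hz
  have hs : [.y 0, .x, lastLetter m 2].Sublist (identityBlock m π p true) :=
    append_sublist_identityBlock (List.nil_sublist _) (y_sublist_blockCore m.zero_le)
      (by simp [lastGroup])
  obtain ⟨r₁, -, h₁, r₂, h₁₂, h₂, r₃, h₂₃, -, r₄, h₃₄, h₄, -⟩ := h.occurInOrder
    (sublist_append_flatMap_append
      (.trans (List.sublist_cons_self Letter.x _) (x_append_x_sublist_identityWord hs))
      (.cons hy (.cons hx (.cons hz (.cons hx .nil))))) (by simp)
  simp only [occursAt_x, occursAt_y] at h₁ h₂ h₄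
  omega

theorem eq_x_of_mem_firstLetter (h : InClass π (A ++ (identityWord m π p q).flatMap g ++ D))
    (hx : .x ∈ g .x) {i : ℕ} (hi : i < 3) (hi₀ : i ≠ 0) (hz : .z (π 0) ∈ g (firstLetter m i)) :
    ∀ d ∈ g (firstLetter m 0), d = .x := by
  intro d hd
  by_contra hdx
  have hπ : blockIndex π (π 0) = 0 := blockIndex_apply π 0
  have hs : [firstLetter m 0, firstLetter m i].Sublist (firstGroup m p) := by
    refine .trans ?_ firstLetters_sublist_firstGroup
    interval_cases i <;> simp at hi₀ ⊢
  have hs : [firstLetter m 0, firstLetter m i].Sublist (identityBlock m π p q) :=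
    append_sublist_identityBlock hs (List.nil_sublist _) (List.nil_sublist _)
  replace hs := sublist_append_flatMap_append (A := A) (D := D)
    (x_append_x_sublist_identityWord hs) (.cons hx (.cons hd (.cons hz (.cons hx .nil))))
  by_cases hdz : d = .z (π 0)
  · subst hdz
    exact h.not_zzx (π 0).2 (.trans (List.sublist_cons_self .x _) hs)
  · obtain ⟨r₁, -, h₁, r₂, h₁₂, -, r₃, h₂₃, h₃, r₄, h₃₄, h₄, -⟩ := h.occurInOrder hs
      (by simp [hdz, Ne.symm hdx])
    simp only [occursAt_x, occursAt_z, hπ] at h₁ h₃ h₄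
    omega

theorem eq_x_of_mem_lastLetter (h : InClass π (A ++ (identityWord m π p q).flatMap g ++ D))
    (hx : .x ∈ g .x) {i : ℕ} (hi : i < 3) (hi₂ : i ≠ 2)
    (hz : .z (π (Fin.last _)) ∈ g (lastLetter m i)) : ∀ d ∈ g (lastLetter m 2), d = .x := by
  intro d hd
  by_contra hdx
  have hπ : blockIndex π (π (Fin.last _)) = m + 1 := blockIndex_apply π (Fin.last _)
  have hs : [lastLetter m i, lastLetter m 2].Sublist (lastGroup m q) := by
    refine .trans ?_ lastLetters_sublist_lastGroup
    interval_cases i <;> simp [List.sublist_cons_iff] at hi₂ ⊢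
  have hs : [lastLetter m i, lastLetter m 2].Sublist (identityBlock m π p q) :=
    append_sublist_identityBlock (List.nil_sublist _) (List.nil_sublist _) hs
  replace hs := sublist_append_flatMap_append (A := A) (D := D)
    (x_append_x_sublist_identityWord hs) (.cons hx (.cons hz (.cons hd (.cons hx .nil))))
  by_cases hdz : d = .z (π (Fin.last _))
  · subst hdz
    exact h.not_zzx (π (Fin.last _)).2 (.trans (List.sublist_cons_self .x _) hs)
  · obtain ⟨r₁, -, h₁, r₂, h₁₂, h₂, r₃, h₂₃, h₃, r₄, h₃₄, h₄, -⟩ := h.occurInOrder hs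
      (by simp [Ne.symm hdz, hdx])
    cases d <;> simp only [occursAt_x, occursAt_y, occursAt_z, occursAt_t, hπ] at h₁ h₂ h₃ h₄ <;>
      omega

theorem collapsesBlock_or_spansBlock
    (h : InClass π (A ++ (identityWord m π p q).flatMap g ++ D)) :
    CollapsesBlock π g ∨ SpansBlock π p q g := by
  refine or_iff_not_imp_left.mpr fun hg => ?_
  simp only [CollapsesBlock, not_or] at hg
  obtain ⟨hgx, hg⟩ := hg
  obtain ⟨c, hx⟩ := List.exists_mem_of_ne_nil _ hgx
  obtain ⟨e, he, d, hd, hdc⟩ : ∃ e ∈ identityBlock m π p q, ∃ d ∈ g e, d ≠ c := by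
    by_contra! hne
    refine hg ⟨c, hx, fun u hu d hd => ?_⟩
    rcases mem_or_eq_x_of_mem_identityBlock_true (p := p) (q := q) hu with hu | rfl
    · exact hne u hu d hd
    · exact h.eq_of_mem (pair_sublist_identityWord (.inr rfl)) hd hx
  obtain rfl : c = .x :=
    h.eq_x_of_enclosed (fun e he => pair_sublist_identityWord (.inl he)) hx he hd hdc.symm
  replace hgx : ∀ c ∈ g .x, c = .x := fun c hc =>
    h.eq_of_mem (pair_sublist_identityWord (.inr rfl)) hc hx
  have hz (i : Fin (m + 2)) : ∃ u ∈ identityBlock m π p q, Letter.z (π i) ∈ g u := by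
    have hπ := blockIndex_apply π i
    exact h.exists_mem_block_of_occurInOrder hx he hd hdc hgx (b := .z (π i))
      ⟨0, le_rfl, .inl rfl, _, by omega, ⟨(π i).2, .inl rfl⟩, _, by omega, .inr rfl, trivial⟩
      (by simp)
  have hy {n : ℕ} (hn : n ≤ m) : Letter.y n ∈ g (.y n) := h.y_mem hx hgx he hd hdc hn
  have hy₀ := hy m.zero_le
  refine ⟨hx, hgx, hy₀, hz, ?_, ?_⟩
  · obtain ⟨u, hu, hzu⟩ := hz 0
    obtain ⟨i, hi, rfl⟩ := h.exists_eq_firstLetter hx hgx hy₀ hu hzu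
    refine ⟨i, hi, hzu, ?_, fun hi₀ => h.eq_x_of_mem_firstLetter hx hi hi₀ hzu⟩
    rintro rfl rfl
    exact h.z_notMem_firstLetter hx hy₀ hzu
  · obtain ⟨u, hu, hzu⟩ := hz (Fin.last _)
    obtain ⟨i, hi, rfl⟩ := h.exists_eq_lastLetter hx hgx (hy le_rfl) hu hzu
    refine ⟨i, hi, hzu, ?_, fun hi₂ => h.eq_x_of_mem_lastLetter hx hi hi₂ hzu⟩
    rintro rfl rfl
    exact h.z_notMem_lastLetter hx hy₀ hzu

end InClass

end

/-! ### Tests -/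

/-- A substitution together with a left and a right context. Tests of a word by means of the
`β`-class of `a0 k π` define the languages whose syntactic monoids are used. -/
structure Test where
  pre : List Letter
  sub : Letter → List Letter
  post : List Letter

namespace Test

/-- The image of `l` under the substitution, put in the context, is in the `β`-class
of `a0 k π`. -/
def Passes (τ : Test) {k : ℕ} (π : Equiv.Perm (Fin k)) (l : List Letter) : Prop :=
  InClass π (τ.pre ++ l.flatMap τ.sub ++ τ.post)

/-- The substitution of a test after another substitution. -/
def comp (τ : Test) (φ : Letter → List Letter) (u : Letter) : List Letter := (φ u).flatMap τ.sub

variable {τ : Test} {k : ℕ} {π : Equiv.Perm (Fin k)} {φ : Letter → List Letter}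
  {P X S : List Letter}

theorem mem_comp {c u : Letter} : c ∈ τ.comp φ u ↔ ∃ e ∈ φ u, c ∈ τ.sub e := List.mem_flatMap

theorem passes_iff : τ.Passes π (P ++ X.flatMap φ ++ S) ↔
    InClass π (τ.pre ++ P.flatMap τ.sub ++ X.flatMap (τ.comp φ) ++
      (S.flatMap τ.sub ++ τ.post)) := by
  rw [Passes, List.flatMap_append, List.flatMap_append, List.flatMap_assoc]
  simp only [List.append_assoc]
  rfl

theorem Passes.ne_of_mem (h : τ.Passes π (P ++ X.flatMap φ ++ S)) {c d u v : Letter}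
    (hcd : c ≠ d) (hc : c ∈ τ.comp φ u) (hd : d ∈ τ.comp φ v) (hu : [u, u].Sublist X) :
    u ≠ v := by
  rintro rfl
  exact hcd ((passes_iff.mp h).eq_of_mem hu hc hd)

end Test

section
variable {m : ℕ} {π : Equiv.Perm (Fin (m + 2))} {p q : Bool} {φ : Letter → List Letter}
  {P S : List Letter} {τ : Test}

theorem Test.Passes.congr_of_collapsesBlock
    (h : τ.Passes π (P ++ (identityWord m π p q).flatMap φ ++ S))
    (hc : CollapsesBlock π (τ.comp φ)) (p' q' : Bool) :
    τ.Passes π (P ++ (identityWord m π p' q').flatMap φ ++ S) :=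
  passes_iff.mpr ((passes_iff.mp h).congr_of_collapsesBlock hc p' q')

theorem not_collapsesBlock_of_mem {g : Letter → List Letter} (hx : .x ∈ g .x)
    (hy : .y 0 ∈ g (.y 0)) : ¬ CollapsesBlock π g := by
  rintro (hnil | ⟨c, -, hc⟩)
  · simp [hnil] at hx
  · have hxc := hc .x (by simp [identityBlock, firstGroup]) .x hx
    have hyc := hc (.y 0) (by simp [identityBlock, blockCore]) (.y 0) hy
    exact Letter.noConfusion (hxc.trans hyc.symm)

/-! ### Tests that select one of three letters -/

/-- The substitution of `selectTest`. -/
def selectSub (π : Equiv.Perm (Fin (m + 2))) (i j : ℕ) : Letter → List Letter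
  | .x => [.x]
  | .y n => [.y n]
  | .z n => if n = m + 2 + i then [.z (π 0)] else if n = m + 5 + j then [.z (π (Fin.last _))]
      else if n < m + 2 ∧ n ≠ π 0 ∧ n ≠ π (Fin.last _) then [.z n] else []
  | .t n => if n = m + 2 + i then [.t (π 0)] else if n = m + 5 + j then [.t (π (Fin.last _))]
      else if n < m + 2 then [.t n] else []

/-- The test that restores the `z`-letters of `a0 (m + 2) π` from `firstLetter m i` and
`lastLetter m j` and erases the other letters of the two triples. -/
def selectTest (π : Equiv.Perm (Fin (m + 2))) (i j : ℕ) : Test := ⟨[], selectSub π i j, []⟩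

theorem eq_x_of_mem_selectSub {i j : ℕ} {u : Letter} (h : .x ∈ selectSub π i j u) : u = .x := by
  cases u <;> simp only [selectSub] at h <;> (try split_ifs at h) <;> simp at h ⊢

theorem eq_y_of_mem_selectSub {i j n : ℕ} {u : Letter} (h : .y n ∈ selectSub π i j u) :
    u = .y n := by
  cases u <;> simp only [selectSub] at h <;> (try split_ifs at h) <;> simp_all

theorem apply_last_ne_apply_zero : π (Fin.last _) ≠ π 0 := by simp [Fin.ext_iff]

theorem eq_firstLetter_of_mem_selectSub {i j : ℕ} {u : Letter}
    (h : .z (π 0) ∈ selectSub π i j u) : u = firstLetter m i := by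
  have h0 := Fin.val_ne_of_ne (apply_last_ne_apply_zero (π := π))
  cases u <;> simp only [selectSub] at h <;> (try split_ifs at h) <;> simp at h ⊢ <;> omega

theorem eq_lastLetter_of_mem_selectSub {i j : ℕ} {u : Letter}
    (h : .z (π (Fin.last _)) ∈ selectSub π i j u) : u = lastLetter m j := by
  have h0 := Fin.val_ne_of_ne (apply_last_ne_apply_zero (π := π))
  cases u <;> simp only [selectSub] at h <;> (try split_ifs at h) <;> simp at h ⊢ <;> omega

theorem collapsesBlock_or_spansBlock_of_selectTest_passes {I : Set (ℕ × ℕ)}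
    (h : ∀ i ∈ I, (selectTest π i.1 i.2).Passes π (P ++ (identityWord m π p q).flatMap φ ++ S)) :
    (∀ i ∈ I, CollapsesBlock π ((selectTest π i.1 i.2).comp φ)) ∨
      ∀ i ∈ I, SpansBlock π p q ((selectTest π i.1 i.2).comp φ) := by
  have hor {i} (hi : i ∈ I) := (Test.passes_iff.mp (h i hi)).collapsesBlock_or_spansBlock
  by_cases hc : ∀ i ∈ I, CollapsesBlock π ((selectTest π i.1 i.2).comp φ)
  · exact .inl hc
  push Not at hc
  obtain ⟨i, hi, hc⟩ := hc
  have hs := (hor hi).resolve_left hc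
  obtain ⟨u, hu, hux⟩ := Test.mem_comp.mp hs.x_mem
  obtain ⟨v, hv, hvy⟩ := Test.mem_comp.mp hs.y_mem
  obtain rfl := eq_x_of_mem_selectSub hux
  obtain rfl := eq_y_of_mem_selectSub hvy
  exact .inr fun j hj => (hor hj).resolve_left <| not_collapsesBlock_of_mem
    (Test.mem_comp.mpr ⟨_, hu, List.mem_singleton_self _⟩)
    (Test.mem_comp.mpr ⟨_, hv, List.mem_singleton_self _⟩)

theorem SpansBlock.exists_firstLetter_mem {i j : ℕ}
    (h : SpansBlock π p q ((selectTest π i j).comp φ)) :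
    ∃ s < 3, firstLetter m i ∈ φ (firstLetter m s) ∧ (p = true → s ≠ 0) ∧
      (s ≠ 0 → ∀ d ∈ (selectTest π i j).comp φ (firstLetter m 0), d = .x) := by
  obtain ⟨s, hs, hz, hs'⟩ := h.exists_firstLetter
  obtain ⟨u, hu, hz⟩ := Test.mem_comp.mp hz
  exact ⟨s, hs, eq_firstLetter_of_mem_selectSub hz ▸ hu, hs'⟩

theorem SpansBlock.exists_lastLetter_mem {i j : ℕ}
    (h : SpansBlock π p q ((selectTest π i j).comp φ)) :
    ∃ s < 3, lastLetter m j ∈ φ (lastLetter m s) ∧ (q = true → s ≠ 2) ∧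
      (s ≠ 2 → ∀ d ∈ (selectTest π i j).comp φ (lastLetter m 2), d = .x) := by
  obtain ⟨s, hs, hz, hs'⟩ := h.exists_lastLetter
  obtain ⟨u, hu, hz⟩ := Test.mem_comp.mp hz
  exact ⟨s, hs, eq_lastLetter_of_mem_selectSub hz ▸ hu, hs'⟩

theorem not_selectTest_passes (i : ℕ) :
    ¬ (selectTest π i 2).Passes π (identityWord m π p true) := by
  intro h
  have h : InClass π ([] ++ (identityWord m π p true).flatMap (selectSub π i 2) ++ []) := h
  rcases h.collapsesBlock_or_spansBlock with h | h
  · exact not_collapsesBlock_of_mem (List.mem_singleton_self _) (List.mem_singleton_self _) h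
  · obtain ⟨s, -, hz, hs, -⟩ := h.exists_lastLetter
    have := eq_lastLetter_of_mem_selectSub hz
    simp only [Letter.z.injEq] at this
    exact hs rfl (by omega)

/-! ### Tests that restrict the order of two letters -/

/-- A splitting of `a0 (m + 2) π` at the two occurrences of the first `z`-letter of the block and
at the second `x`. -/
structure Splitting (π : Equiv.Perm (Fin (m + 2))) where
  rest : List Letter
  mid : List Letter
  post : List Letter
  eq : (a0 (m + 2) π).toList = .x :: .z (π 0) :: .y 0 :: .y 0 :: rest ++ .x :: mid ++
    .z (π 0) :: post
  z_mem : .z (π 1) ∈ rest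
  t_mem : .t (π 0) ∈ mid
  y_notMem : .y 0 ∉ mid

theorem nonempty_splitting (π : Equiv.Perm (Fin (m + 2))) : Nonempty (Splitting π) := by
  obtain ⟨B, hB⟩ : ∃ B, blockCore m π ++ [.z (π (Fin.last _))] = .y 0 :: .y 0 :: B := ⟨_, rfl⟩
  obtain ⟨L, L', hL⟩ := List.append_of_mem (List.mem_ofFn.mpr
    ⟨π 0, rfl⟩ : [Letter.t (π 0), .z (π 0)] ∈ List.ofFn fun i : Fin (m + 2) => [Letter.t i, .z i])
  refine ⟨⟨B, L.flatten ++ [.t (π 0)], L'.flatten, ?_, ?_, by simp, ?_⟩⟩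
  · rw [toList_a0, hL, List.append_cons, List.cons_append, List.cons_append (bs := [_]), hB]
    simp
  · have hz : .z (π 1) ∈ blockCore m π ++ [.z (π (Fin.last _))] := by
      cases m with
      | zero => exact List.mem_append_right _ (List.mem_singleton_self _)
      | succ m =>
        exact List.mem_append_left _ ((yzy_sublist_blockCore (π := π) 0).subset (by simp))
    simpa [hB] using hz
  · have hy : .y 0 ∉ (L ++ [Letter.t (π 0), .z (π 0)] :: L').flatten := by
      simp [← hL, List.mem_flatten, List.mem_ofFn]
    simp only [List.flatten_append, List.mem_append, not_or] at hy
    simp [hy.1]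

variable (σ : Splitting π)

/-- The substitution of `betweenTest`. -/
def betweenSub (u v s : Letter) (a : Letter) : List Letter :=
  if a = u then [.z (π 0)] else if a = v then [.y 0] else if a = s then σ.rest ++ .x :: σ.mid
  else []

/-- A test that `u` does not occur between two occurrences of `v`; the simple letter `s` carries
the part of `a0 (m + 2) π` between the letters that represent `u` and `v`. -/
def betweenTest (u v s : Letter) : Test := ⟨[.x], betweenSub σ u v s, σ.post⟩

/-- The substitution of `nestingTest`. -/
def nestingSub (u v s t : Letter) (a : Letter) : List Letter :=
  if a = u then [.x] else if a = v then [.z (π 0)] else if a = s then .y 0 :: .y 0 :: σ.rest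
  else if a = t then σ.mid else []

/-- A test that `v` does not occur twice between two occurrences of `u`; the simple letters `s`
and `t` carry the parts of `a0 (m + 2) π` between the letters that represent `u` and `v`. -/
def nestingTest (u v s t : Letter) : Test := ⟨[], nestingSub σ u v s t, σ.post⟩

variable {σ} {u v s t : Letter}

theorem z_mem_comp_betweenTest {u' : Letter} (hu : u ∈ φ u') :
    .z (π 0) ∈ (betweenTest σ u v s).comp φ u' :=
  Test.mem_comp.mpr ⟨u, hu, by simp [betweenTest, betweenSub]⟩

theorem y_mem_comp_betweenTest (huv : u ≠ v) {v' : Letter} (hv : v ∈ φ v') :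
    .y 0 ∈ (betweenTest σ u v s).comp φ v' :=
  Test.mem_comp.mpr ⟨v, hv, by simp [betweenTest, betweenSub, huv.symm]⟩

theorem x_mem_comp_nestingTest {u' : Letter} (hu : u ∈ φ u') :
    .x ∈ (nestingTest σ u v s t).comp φ u' :=
  Test.mem_comp.mpr ⟨u, hu, by simp [nestingTest, nestingSub]⟩

theorem z_mem_comp_nestingTest (huv : u ≠ v) {v' : Letter} (hv : v ∈ φ v') :
    .z (π 0) ∈ (nestingTest σ u v s t).comp φ v' :=
  Test.mem_comp.mpr ⟨v, hv, by simp [nestingTest, nestingSub, huv.symm]⟩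

theorem collapsesBlock_of_betweenTest_passes
    (h : (betweenTest σ u v s).Passes π (P ++ (identityWord m π p q).flatMap φ ++ S)) :
    CollapsesBlock π ((betweenTest σ u v s).comp φ) := by
  have h := Test.passes_iff.mp h
  refine h.collapsesBlock_or_spansBlock.resolve_right fun hs => ?_
  obtain ⟨w, hw, hz⟩ := hs.exists_z_mem 1
  obtain ⟨a, ha, hz⟩ := Test.mem_comp.mp hz
  -- Only `s` yields the letter `z (π 1)`, and `s` also yields the simple letter `t (π 0)`.
  have ht : .t (π 0) ∈ (betweenTest σ u v s).sub a := by
    have hz0 : (π 1 : ℕ) ≠ π 0 := Fin.val_ne_of_ne (by simp)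
    simp only [betweenTest, betweenSub] at hz ⊢
    split_ifs at hz ⊢ <;> simp_all [σ.t_mem]
  exact h.t_notMem (pair_sublist_identityWord (.inl hw)) (π 0).2 (Test.mem_comp.mpr ⟨a, ha, ht⟩)

theorem collapsesBlock_of_nestingTest_passes
    (h : (nestingTest σ u v s t).Passes π (P ++ (identityWord m π p q).flatMap φ ++ S)) :
    CollapsesBlock π ((nestingTest σ u v s t).comp φ) := by
  have h := Test.passes_iff.mp h
  refine h.collapsesBlock_or_spansBlock.resolve_right fun hs => ?_
  obtain ⟨a, ha, hy⟩ := Test.mem_comp.mp hs.y_mem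
  -- Only `s` yields the letter `y 0`, and `s` also yields `z (π 1)`.
  have hz : .z (π 1) ∈ (nestingTest σ u v s t).sub a := by
    simp only [nestingTest, nestingSub] at hy ⊢
    split_ifs at hy ⊢ <;> simp_all [σ.y_notMem, σ.z_mem]
  have hyz := h.eq_of_mem (pair_sublist_identityWord (.inl (List.singleton_sublist.mp
    (sublist_identityBlock (y_sublist_blockCore m.zero_le))))) hs.y_mem
    (Test.mem_comp.mpr ⟨a, ha, hz⟩)
  exact Letter.noConfusion hyz

theorem not_sublist_of_betweenTest_passes {X : List Letter} (huv : u ≠ v)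
    (h : (betweenTest σ u v s).Passes π (P ++ X.flatMap φ ++ S)) {u' v' : Letter}
    (hu : u ∈ φ u') (hv : v ∈ φ v') : ¬ [v', u', v'].Sublist X := by
  intro hs
  have hu := z_mem_comp_betweenTest (σ := σ) (v := v) (s := s) hu
  have hv := y_mem_comp_betweenTest (σ := σ) (s := s) huv hv
  obtain ⟨a, -, ha, b, hab, -, c, hbc, hc, -⟩ := (Test.passes_iff.mp h).occurInOrder
    (sublist_append_flatMap_append hs (.cons hv (.cons hu (.cons hv .nil)))) (by simp)
  simp only [occursAt_y] at ha hc
  omega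

theorem not_sublist_of_nestingTest_passes {X : List Letter} (huv : u ≠ v)
    (h : (nestingTest σ u v s t).Passes π (P ++ X.flatMap φ ++ S)) {u' v' : Letter}
    (hu : u ∈ φ u') (hv : v ∈ φ v') : ¬ [u', v', v', u'].Sublist X := by
  intro hs
  have hu := x_mem_comp_nestingTest (σ := σ) (v := v) (s := s) (t := t) hu
  have hv := z_mem_comp_nestingTest (σ := σ) (s := s) (t := t) huv hv
  exact (Test.passes_iff.mp h).not_zzx (π 0).2 (.trans (List.sublist_cons_self .x _)
    (sublist_append_flatMap_append hs (.cons hu (.cons hv (.cons hv (.cons hu .nil))))))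

theorem eq_and_eq_of_betweenTest_passes_firstLetter (huv : u ≠ v)
    (h : (betweenTest σ u v s).Passes π (P ++ (identityWord m π p q).flatMap φ ++ S)) {i j : ℕ}
    (hi : i < 3) (hj : j < 3) (hu : u ∈ φ (firstLetter m i)) (hv : v ∈ φ (firstLetter m j)) :
    i = 1 ∧ j = 2 := by
  have hne : i ≠ j := fun hij => h.ne_of_mem Letter.noConfusion (z_mem_comp_betweenTest hu)
    (y_mem_comp_betweenTest huv hv)
    (map_firstLetter_sublist_identityWord (l := [i, i]) (by interval_cases i <;> decide))
    (congrArg _ hij)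
  have hns : ¬ [j, i, j].Sublist [0, 1, 2, 0, 2, 1] := fun hs =>
    not_sublist_of_betweenTest_passes huv h hu hv (map_firstLetter_sublist_identityWord hs)
  revert hne hns
  interval_cases i <;> interval_cases j <;> decide

theorem eq_and_eq_of_betweenTest_passes_lastLetter (huv : u ≠ v)
    (h : (betweenTest σ u v s).Passes π (P ++ (identityWord m π p q).flatMap φ ++ S)) {i j : ℕ}
    (hi : i < 3) (hj : j < 3) (hu : u ∈ φ (lastLetter m i)) (hv : v ∈ φ (lastLetter m j)) :
    i = 0 ∧ j = 1 := by
  have hne : i ≠ j := fun hij => h.ne_of_mem Letter.noConfusion (z_mem_comp_betweenTest hu)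
    (y_mem_comp_betweenTest huv hv)
    (map_lastLetter_sublist_identityWord (l := [i, i]) (by interval_cases i <;> decide))
    (congrArg _ hij)
  have hns : ¬ [j, i, j].Sublist [0, 1, 2, 1, 0, 2] := fun hs =>
    not_sublist_of_betweenTest_passes huv h hu hv (map_lastLetter_sublist_identityWord hs)
  revert hne hns
  interval_cases i <;> interval_cases j <;> decide

theorem eq_of_nestingTest_passes_firstLetter (huv : u ≠ v)
    (h : (nestingTest σ u v s t).Passes π (P ++ (identityWord m π p q).flatMap φ ++ S)) {i : ℕ}
    (hi : i < 3) (hu : u ∈ φ (firstLetter m i)) (hv : v ∈ φ (firstLetter m 2)) : i = 0 := by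
  have hne : i ≠ 2 := fun hij => h.ne_of_mem Letter.noConfusion (x_mem_comp_nestingTest hu)
    (z_mem_comp_nestingTest huv hv)
    (map_firstLetter_sublist_identityWord (l := [i, i]) (by interval_cases i <;> decide))
    (congrArg _ hij)
  have hns : ¬ [i, 2, 2, i].Sublist [0, 1, 2, 0, 2, 1] := fun hs =>
    not_sublist_of_nestingTest_passes huv h hu hv (map_firstLetter_sublist_identityWord hs)
  revert hne hns
  interval_cases i <;> decide

theorem eq_of_nestingTest_passes_lastLetter (huv : u ≠ v)
    (h : (nestingTest σ u v s t).Passes π (P ++ (identityWord m π p q).flatMap φ ++ S)) {j : ℕ}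
    (hj : j < 3) (hu : u ∈ φ (lastLetter m 0)) (hv : v ∈ φ (lastLetter m j)) : j = 2 := by
  have hne : 0 ≠ j := fun hij => h.ne_of_mem Letter.noConfusion (x_mem_comp_nestingTest hu)
    (z_mem_comp_nestingTest huv hv)
    (map_lastLetter_sublist_identityWord (l := [0, 0]) (by decide)) (congrArg _ hij)
  have hns : ¬ [0, j, j, 0].Sublist [0, 1, 2, 1, 0, 2] := fun hs =>
    not_sublist_of_nestingTest_passes huv h hu hv (map_lastLetter_sublist_identityWord hs)
  revert hne hns
  interval_cases j <;> decide

end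

/-! ### The values of the words of the identities under the tests -/

theorem flatMap_flatten_ofFn {α β : Type*} {n : ℕ} (f : Fin n → List α) (g : α → List β) :
    (List.ofFn f).flatten.flatMap g = (List.ofFn fun i => (f i).flatMap g).flatten := by
  rw [← List.flatMap_id, List.flatMap_assoc, List.flatMap_def, List.map_ofFn]
  rfl

theorem inClass_a0 {k : ℕ} {π : Equiv.Perm (Fin k)} : InClass π (a0 k π).toList :=
  beta.refl _

section
variable {m : ℕ} {π : Equiv.Perm (Fin (m + 2))}

theorem blockCore_flatMap_selectSub (i j : ℕ) :
    (blockCore m π).flatMap (selectSub π i j) = blockCore m π := by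
  conv_rhs => rw [← List.flatMap_singleton' (blockCore m π)]
  refine List.flatMap_congr fun u hu => ?_
  rcases mem_blockCore hu with ⟨n, -, rfl⟩ | ⟨n, rfl⟩
  · rfl
  · have hlt := (π n.castSucc.succ).2
    have hfirst : π n.castSucc.succ ≠ π 0 := π.injective.ne (Fin.succ_ne_zero _)
    have hlast : π n.castSucc.succ ≠ π (Fin.last _) := by
      rw [Fin.succ_castSucc]
      exact π.injective.ne (Fin.castSucc_lt_last _).ne
    rw [selectSub, if_neg (by omega), if_neg (by omega),
      if_pos ⟨hlt, Fin.val_ne_of_ne hfirst, Fin.val_ne_of_ne hlast⟩]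

theorem identityTail_flatMap_selectSub {i j : ℕ} (hi : i < 3) (hj : j < 3) :
    (identityTail m π).flatMap (selectSub π i j) =
      (List.ofFn fun i : Fin (m + 2) => [Letter.t i, .z i]).flatten := by
  rw [identityTail, flatMap_flatten_ofFn]
  refine congrArg (fun f => (List.ofFn f).flatten) (funext fun n => ?_)
  unfold tailFactor
  split_ifs with hfirst hlast
  · subst hfirst
    interval_cases i <;> interval_cases j <;> simp [selectSub]
  · subst hlast
    interval_cases i <;> interval_cases j <;> simp [selectSub]
  · have hlt := n.2
    have hi' : (n : ℕ) ≠ m + 2 + i := by omega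
    have hj' : (n : ℕ) ≠ m + 5 + j := by omega
    rw [← Ne, ← Fin.val_ne_iff] at hfirst hlast
    simp [selectSub, hi', hj', hfirst, hlast, hlt]

theorem identityWord_flatMap_selectSub {i j : ℕ} (hi : i < 3) (hj : j < 3) :
    (identityWord m π false false).flatMap (selectSub π i j) = (a0 (m + 2) π).toList := by
  have hfirst : (firstGroup m false).flatMap (selectSub π i j) = [.z (π 0)] := by
    interval_cases i <;> interval_cases j <;> simp [firstGroup, selectSub]
  have hlast : (lastGroup m false).flatMap (selectSub π i j) = [.z (π (Fin.last _))] := by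
    interval_cases j <;> interval_cases i <;> simp [lastGroup, selectSub]
  simp only [toList_a0, identityWord, identityBlock, List.cons_append, List.flatMap_cons,
    List.flatMap_append, hfirst, hlast, blockCore_flatMap_selectSub,
    identityTail_flatMap_selectSub hi hj]
  simp [selectSub]

theorem selectTest_passes {i j : ℕ} (hi : i < 3) (hj : j < 3) :
    (selectTest π i j).Passes π (identityWord m π false false) := by
  simp only [Test.Passes, selectTest, identityWord_flatMap_selectSub hi hj, List.nil_append,
    List.append_nil]
  exact inClass_a0

theorem ne_of_mem_tailFactor_of_ne_zero {i : Fin (m + 2)} (hi : i ≠ π 0) {u : Letter}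
    (hu : u ∈ tailFactor m π i) {s : ℕ} (hs : s < 3) :
    u ≠ firstLetter m s ∧ u ≠ .t (m + 2 + s) := by
  have := i.2
  rw [tailFactor, if_neg hi] at hu
  grind

theorem ne_of_mem_tailFactor_of_ne_last {i : Fin (m + 2)} (hi : i ≠ π (Fin.last _)) {u : Letter}
    (hu : u ∈ tailFactor m π i) (s : ℕ) :
    u ≠ lastLetter m s ∧ u ≠ .t (m + 5 + s) := by
  have := i.2
  rw [tailFactor, if_neg hi] at hu
  grind

theorem identityWord_flatMap_of_forall_eq_nil {g : Letter → List Letter} {a : ℕ} {n : Fin (m + 2)}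
    (ha : m + 2 ≤ a)
    (hg : ∀ u, (∀ s < 3, u ≠ .z (a + s) ∧ u ≠ .t (a + s)) → g u = [])
    (hn : ∀ i, i ≠ n → ∀ u ∈ tailFactor m π i, ∀ s < 3, u ≠ .z (a + s) ∧ u ≠ .t (a + s)) :
    (identityWord m π false false).flatMap g =
      (firstGroup m false ++ lastGroup m false ++ tailFactor m π n).flatMap g := by
  have hx : g .x = [] := hg _ (by simp)
  have hcore : (blockCore m π).flatMap g = [] := by
    refine List.flatMap_eq_nil_iff.mpr fun u hu => hg u fun s _ => ?_
    rcases mem_blockCore hu with ⟨j, -, rfl⟩ | ⟨i, rfl⟩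
    · simp
    · have := (π i.castSucc.succ).2
      simp only [ne_eq, Letter.z.injEq, reduceCtorEq, not_false_eq_true, and_true]
      omega
  have htail : (identityTail m π).flatMap g = (tailFactor m π n).flatMap g := by
    rw [identityTail, flatMap_flatten_ofFn]
    exact flatten_ofFn_eq_of_forall_ne n fun i hi =>
      List.flatMap_eq_nil_iff.mpr fun u hu => hg u (hn i hi u hu)
  simp only [identityWord, identityBlock, List.cons_append, List.flatMap_cons,
    List.flatMap_append, hx, hcore, htail, List.nil_append, List.append_assoc]

variable (σ : Splitting π)

theorem betweenTest_firstLetter_passes :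
    (betweenTest σ (firstLetter m 1) (firstLetter m 2) (.t (m + 2 + 1))).Passes π
      (identityWord m π false false) := by
  have h := inClass_a0 (π := π)
  rw [σ.eq] at h
  rw [Test.Passes, identityWord_flatMap_of_forall_eq_nil (a := m + 2) (n := π 0) le_rfl]
  · simpa [firstGroup, lastGroup, tailFactor, betweenTest, betweenSub] using h
  · intro u hu
    simp [betweenTest, betweenSub, hu]
  · exact fun i hi u hu s hs => ne_of_mem_tailFactor_of_ne_zero hi hu hs

theorem nestingTest_firstLetter_passes :
    (nestingTest σ (firstLetter m 0) (firstLetter m 2) (.t (m + 2)) (.t (m + 2 + 2))).Passes π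
      (identityWord m π false false) := by
  have h := inClass_a0 (π := π)
  rw [σ.eq] at h
  rw [Test.Passes, identityWord_flatMap_of_forall_eq_nil (a := m + 2) (n := π 0) le_rfl]
  · simpa [firstGroup, lastGroup, tailFactor, nestingTest, nestingSub] using h
  · intro u hu
    have := hu 0 (by simp)
    simp_all [nestingTest, nestingSub]
  · exact fun i hi u hu s hs => ne_of_mem_tailFactor_of_ne_zero hi hu hs

theorem betweenTest_lastLetter_passes :
    (betweenTest σ (lastLetter m 0) (lastLetter m 1) (.t (m + 5))).Passes π
      (identityWord m π false false) := by
  have h := inClass_a0 (π := π)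
  rw [σ.eq] at h
  rw [Test.Passes, identityWord_flatMap_of_forall_eq_nil (a := m + 5) (n := π (Fin.last _))
    (by simp)]
  · simpa [firstGroup, lastGroup, tailFactor, betweenTest, betweenSub] using h
  · intro u hu
    have := hu 0 (by simp)
    simp_all [betweenTest, betweenSub]
  · exact fun i hi u hu s _ => ne_of_mem_tailFactor_of_ne_last hi hu s

theorem nestingTest_lastLetter_passes :
    (nestingTest σ (lastLetter m 0) (lastLetter m 2) (.t (m + 5)) (.t (m + 5 + 2))).Passes π
      (identityWord m π false false) := by
  have h := inClass_a0 (π := π)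
  rw [σ.eq] at h
  rw [Test.Passes, identityWord_flatMap_of_forall_eq_nil (a := m + 5) (n := π (Fin.last _))
    (by simp)]
  · simpa [firstGroup, lastGroup, tailFactor, nestingTest, nestingSub] using h
  · intro u hu
    have := hu 0 (by simp)
    simp_all [nestingTest, nestingSub]
  · exact fun i hi u hu s _ => ne_of_mem_tailFactor_of_ne_last hi hu s

end

/-! ### Sets of tests -/

theorem forall_mem_union {α : Type*} {s t : Set α} {p : α → Prop} :
    (∀ x ∈ s ∪ t, p x) ↔ (∀ x ∈ s, p x) ∧ ∀ x ∈ t, p x := by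
  simp only [Set.mem_union, or_imp, forall_and]

/-- The language of the words that pass all tests of a set. -/
def passing {k : ℕ} (π : Equiv.Perm (Fin k)) (𝒯 : Set Test) : Set Word :=
  {w | ∀ τ ∈ 𝒯, τ.Passes π w.toList}

section
variable {k : ℕ} {π : Equiv.Perm (Fin k)} {𝒯 : Set Test}

theorem passing_union {𝒯' : Set Test} : passing π (𝒯 ∪ 𝒯') = passing π 𝒯 ∩ passing π 𝒯' :=
  Set.ext fun _ => forall_mem_union

theorem Test.Passes.of_satisfies {τ : Test} {e : MonoidIdentity} {θ : Letter → Word} {p s : Word}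
    (hp : τ.Passes π (p * FreeMonoid.lift θ e.1 * s).toList)
    (h : Satisfies (SapirMonoid beta {(a0 k π : beta.Quotient)}) e) :
    τ.Passes π (p * FreeMonoid.lift θ e.2 * s).toList := by
  let ψ : Word →* Word := FreeMonoid.lift fun a => FreeMonoid.ofList (τ.sub a)
  have hpasses (w : Word) : τ.Passes π (p * FreeMonoid.lift θ w * s).toList ↔
      beta (FreeMonoid.ofList τ.pre * ψ p * FreeMonoid.lift (ψ ∘ θ) w *
        (ψ s * FreeMonoid.ofList τ.post)) (a0 k π) := by
    have hψ (w : Word) : FreeMonoid.ofList (w.toList.flatMap τ.sub) = ψ w :=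
      FreeMonoid.toList.injective (toList_lift _ w).symm
    rw [← FreeMonoid.hom_map_lift]
    simp only [Test.Passes, InClass, FreeMonoid.ofList_append, hψ, map_mul, mul_assoc]
    rfl
  exact (hpasses _).mpr (SapirMonoid.rel_of_satisfies h rfl ((hpasses _).mp hp))

theorem syntacticMonoid_passing_mem : syntacticMonoid.{u} (passing π 𝒯) ∈
    (MonoidVariety.generatedBy.{u, 0}
      (SapirMonoid beta {(a0 k π : beta.Quotient)})).carrier := fun e he =>
  satisfies_syntacticMonoid_iff.mpr fun _ _ _ =>
    ⟨fun hp τ hτ => (hp τ hτ).of_satisfies he,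
      fun hp τ hτ => (hp τ hτ).of_satisfies (e := e.swap) (Satisfies.symm he)⟩

theorem satisfies_syntacticMonoid_passing_union {𝒯' : Set Test} {e : MonoidIdentity}
    (h : Satisfies (syntacticMonoid.{u} (passing π 𝒯)) e)
    (h' : Satisfies (syntacticMonoid.{u} (passing π 𝒯')) e) :
    Satisfies (syntacticMonoid.{u} (passing π (𝒯 ∪ 𝒯'))) e :=
  passing_union ▸ satisfies_syntacticMonoid_inter h h'

theorem satisfies_syntacticMonoid_passing {u v : List Letter}
    (h : ∀ (φ : Letter → List Letter) (P S : List Letter),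
      (∀ τ ∈ 𝒯, τ.Passes π (P ++ u.flatMap φ ++ S)) ↔
        ∀ τ ∈ 𝒯, τ.Passes π (P ++ v.flatMap φ ++ S)) :
    Satisfies (syntacticMonoid.{u} (passing π 𝒯)) (FreeMonoid.ofList u, FreeMonoid.ofList v) := by
  refine satisfies_syntacticMonoid_iff.mpr fun θ p s => ?_
  simpa only [passing, Set.mem_ofPred_eq, FreeMonoid.toList_mul, toList_lift,
    FreeMonoid.toList_ofList] using h (fun a => (θ a).toList) p.toList s.toList

end

section
variable {m : ℕ} {π : Equiv.Perm (Fin (m + 2))} (σ : Splitting π)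

/-- The tests whose syntactic monoid allows an `x` to be inserted before `lastLetter m 2` in
`identityWord m π p q`, that is, changing `q`. -/
def lastTests : Set Test :=
  (fun i : ℕ × ℕ => selectTest π i.1 i.2) '' {(0, 0), (0, 1)} ∪
    {betweenTest σ (lastLetter m 0) (lastLetter m 1) (.t (m + 5)),
      nestingTest σ (lastLetter m 0) (lastLetter m 2) (.t (m + 5)) (.t (m + 5 + 2))}

/-- The tests whose syntactic monoid allows an `x` to be inserted after `firstLetter m 0` in
`identityWord m π p q`, that is, changing `p`. -/
def firstTests : Set Test :=
  (fun i : ℕ × ℕ => selectTest π i.1 i.2) '' {(1, 2), (2, 2)} ∪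
    {betweenTest σ (firstLetter m 1) (firstLetter m 2) (.t (m + 2 + 1)),
      nestingTest σ (firstLetter m 0) (firstLetter m 2) (.t (m + 2)) (.t (m + 2 + 2))}

variable {σ} {p q : Bool} {φ : Letter → List Letter} {P S : List Letter}

theorem forall_mem_lastTests {C : Test → Prop} : (∀ τ ∈ lastTests σ, C τ) ↔
    (∀ i ∈ ({(0, 0), (0, 1)} : Set (ℕ × ℕ)), C (selectTest π i.1 i.2)) ∧
    C (betweenTest σ (lastLetter m 0) (lastLetter m 1) (.t (m + 5))) ∧
    C (nestingTest σ (lastLetter m 0) (lastLetter m 2) (.t (m + 5)) (.t (m + 5 + 2))) := by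
  simp only [lastTests, forall_mem_union, Set.forall_mem_image, Set.forall_mem_insert,
    Set.mem_singleton_iff, forall_eq]

theorem forall_mem_firstTests {C : Test → Prop} : (∀ τ ∈ firstTests σ, C τ) ↔
    (∀ i ∈ ({(1, 2), (2, 2)} : Set (ℕ × ℕ)), C (selectTest π i.1 i.2)) ∧
    C (betweenTest σ (firstLetter m 1) (firstLetter m 2) (.t (m + 2 + 1))) ∧
    C (nestingTest σ (firstLetter m 0) (firstLetter m 2) (.t (m + 2)) (.t (m + 2 + 2))) := by
  simp only [firstTests, forall_mem_union, Set.forall_mem_image, Set.forall_mem_insert,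
    Set.mem_singleton_iff, forall_eq]

theorem lastTests_passes_congr
    (h : ∀ τ ∈ lastTests σ, τ.Passes π (P ++ (identityWord m π p q).flatMap φ ++ S)) (q' : Bool) :
    ∀ τ ∈ lastTests σ, τ.Passes π (P ++ (identityWord m π p q').flatMap φ ++ S) := by
  rw [forall_mem_lastTests] at h ⊢
  obtain ⟨hsel, hbtw, hnest⟩ := h
  refine ⟨?_, hbtw.congr_of_collapsesBlock (collapsesBlock_of_betweenTest_passes hbtw) _ _,
    hnest.congr_of_collapsesBlock (collapsesBlock_of_nestingTest_passes hnest) _ _⟩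
  rcases collapsesBlock_or_spansBlock_of_selectTest_passes hsel with hc | hs
  · exact fun i hi => (hsel i hi).congr_of_collapsesBlock (hc i hi) _ _
  · obtain ⟨i, hi, hi0, -, hxi⟩ := (hs (0, 0) (.inl rfl)).exists_lastLetter_mem
    obtain ⟨j, hj, hj1, -, hxj⟩ := (hs (0, 1) (.inr rfl)).exists_lastLetter_mem
    obtain ⟨rfl, rfl⟩ :=
      eq_and_eq_of_betweenTest_passes_lastLetter (by simp) hbtw hi hj hi0 hj1
    have hcongr {r : ℕ × ℕ} (hr : r ∈ ({(0, 0), (0, 1)} : Set (ℕ × ℕ)))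
        (hx : ∀ d ∈ (selectTest π r.1 r.2).comp φ (lastLetter m 2), d = .x) :=
      Test.passes_iff.mpr ((Test.passes_iff.mp (hsel r hr)).congr_lastGroup (hs r hr).x_mem
        (hs r hr).eq_x hx q')
    rintro _ (rfl | rfl)
    exacts [hcongr (.inl rfl) (hxi (by simp)), hcongr (.inr rfl) (hxj (by simp))]

theorem firstTests_passes_congr
    (h : ∀ τ ∈ firstTests σ, τ.Passes π (P ++ (identityWord m π p q).flatMap φ ++ S)) (p' : Bool) :
    ∀ τ ∈ firstTests σ, τ.Passes π (P ++ (identityWord m π p' q).flatMap φ ++ S) := by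
  rw [forall_mem_firstTests] at h ⊢
  obtain ⟨hsel, hbtw, hnest⟩ := h
  refine ⟨?_, hbtw.congr_of_collapsesBlock (collapsesBlock_of_betweenTest_passes hbtw) _ _,
    hnest.congr_of_collapsesBlock (collapsesBlock_of_nestingTest_passes hnest) _ _⟩
  rcases collapsesBlock_or_spansBlock_of_selectTest_passes hsel with hc | hs
  · exact fun i hi => (hsel i hi).congr_of_collapsesBlock (hc i hi) _ _
  · obtain ⟨i, hi, hi1, -, hxi⟩ := (hs (1, 2) (.inl rfl)).exists_firstLetter_mem
    obtain ⟨j, hj, hj2, -, hxj⟩ := (hs (2, 2) (.inr rfl)).exists_firstLetter_mem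
    obtain ⟨rfl, rfl⟩ :=
      eq_and_eq_of_betweenTest_passes_firstLetter (by simp) hbtw hi hj hi1 hj2
    have hcongr {r : ℕ × ℕ} (hr : r ∈ ({(1, 2), (2, 2)} : Set (ℕ × ℕ)))
        (hx : ∀ d ∈ (selectTest π r.1 r.2).comp φ (firstLetter m 0), d = .x) :=
      Test.passes_iff.mpr ((Test.passes_iff.mp (hsel r hr)).congr_firstGroup (hs r hr).x_mem
        (hs r hr).eq_x hx p')
    rintro _ (rfl | rfl)
    exacts [hcongr (.inl rfl) (hxi (by simp)), hcongr (.inr rfl) (hxj (by simp))]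

theorem collapsesBlock_of_lastTests_union_firstTests_passes
    (h : ∀ τ ∈ lastTests σ ∪ firstTests σ,
      τ.Passes π (P ++ (identityWord m π p q).flatMap φ ++ S))
    (hpq : p = true ∨ q = true) :
    ∀ τ ∈ lastTests σ ∪ firstTests σ, CollapsesBlock π (τ.comp φ) := by
  rw [forall_mem_union, forall_mem_lastTests, forall_mem_firstTests] at h ⊢
  obtain ⟨⟨hsel, hbtw, hnest⟩, hsel', hbtw', hnest'⟩ := h
  suffices hc : ∀ i ∈ ({(0, 0), (0, 1)} ∪ {(1, 2), (2, 2)} : Set (ℕ × ℕ)),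
      CollapsesBlock π ((selectTest π i.1 i.2).comp φ) by
    rw [forall_mem_union] at hc
    exact ⟨⟨hc.1, collapsesBlock_of_betweenTest_passes hbtw,
      collapsesBlock_of_nestingTest_passes hnest⟩, hc.2,
      collapsesBlock_of_betweenTest_passes hbtw', collapsesBlock_of_nestingTest_passes hnest'⟩
  refine (collapsesBlock_or_spansBlock_of_selectTest_passes
    (forall_mem_union.mpr ⟨hsel, hsel'⟩)).resolve_right fun hs => ?_
  rcases hpq with rfl | rfl
  · obtain ⟨i, hi, hi0, hne, -⟩ := (hs (0, 0) (by simp)).exists_firstLetter_mem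
    obtain ⟨j, hj, hj1, -⟩ := (hs (1, 2) (by simp)).exists_firstLetter_mem
    obtain ⟨l, hl, hl2, -⟩ := (hs (2, 2) (by simp)).exists_firstLetter_mem
    obtain ⟨rfl, rfl⟩ :=
      eq_and_eq_of_betweenTest_passes_firstLetter (by simp) hbtw' hj hl hj1 hl2
    exact hne rfl (eq_of_nestingTest_passes_firstLetter (by simp) hnest' hi hi0 hl2)
  · obtain ⟨i, hi, hi0, -⟩ := (hs (0, 0) (by simp)).exists_lastLetter_mem
    obtain ⟨j, hj, hj1, -⟩ := (hs (0, 1) (by simp)).exists_lastLetter_mem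
    obtain ⟨l, hl, hl2, hne, -⟩ := (hs (1, 2) (by simp)).exists_lastLetter_mem
    obtain ⟨rfl, rfl⟩ := eq_and_eq_of_betweenTest_passes_lastLetter (by simp) hbtw hi hj hi0 hj1
    exact hne rfl (eq_of_nestingTest_passes_lastLetter (by simp) hnest hl hi0 hl2)

theorem lastTests_union_firstTests_passes_congr
    (h : ∀ τ ∈ lastTests σ ∪ firstTests σ,
      τ.Passes π (P ++ (identityWord m π p q).flatMap φ ++ S))
    (hpq : p = true ∨ q = true) (p' q' : Bool) :
    ∀ τ ∈ lastTests σ ∪ firstTests σ,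
      τ.Passes π (P ++ (identityWord m π p' q').flatMap φ ++ S) := fun τ hτ =>
  (h τ hτ).congr_of_collapsesBlock
    (collapsesBlock_of_lastTests_union_firstTests_passes h hpq τ hτ) p' q'

theorem identityWord_mem_passing : FreeMonoid.ofList (identityWord m π false false) ∈
    passing π (lastTests σ ∪ firstTests σ) := by
  refine forall_mem_union.mpr ⟨forall_mem_lastTests.mpr ⟨?_,
    betweenTest_lastLetter_passes σ, nestingTest_lastLetter_passes σ⟩,
    forall_mem_firstTests.mpr ⟨?_,
    betweenTest_firstLetter_passes σ, nestingTest_firstLetter_passes σ⟩⟩ <;>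
  · rintro _ (rfl | rfl) <;> exact selectTest_passes (by simp) (by simp)

theorem identityWord_notMem_passing : FreeMonoid.ofList (identityWord m π false true) ∉
    passing π (lastTests σ ∪ firstTests σ) := fun h =>
  not_selectTest_passes 1 (h _ (.inr (.inl ⟨(1, 2), .inl rfl, rfl⟩)))

end

end Word

open Word MonoidVariety in
/-- For every `k ≥ 2` and every `π ∈ S_k`, the lattice of subvarieties of the variety generated by
the monoid `M_β([a_{0,k}[π]]^β)` is not distributive. -/
theorem mainTheorem5 (k : ℕ) (hk : 2 ≤ k) (π : Equiv.Perm (Fin k)) :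
    ¬ (MonoidVariety.generatedBy.{u, 0}
        (SapirMonoid Word.beta {(Word.a0 k π : Word.beta.Quotient)})).IsDistributive := by
  obtain ⟨m, rfl⟩ := Nat.exists_eq_add_of_le' hk
  obtain ⟨σ⟩ := nonempty_splitting π
  let w (p q : Bool) : Word := FreeMonoid.ofList (identityWord m π p q)
  let L (𝒯 : Set Test) : MonCat.{u} := syntacticMonoid (passing π 𝒯)
  have hlast : Satisfies (L (lastTests σ)) (w false false, w false true) :=
    satisfies_syntacticMonoid_passing fun _ _ _ =>
      ⟨fun h => lastTests_passes_congr h _, fun h => lastTests_passes_congr h _⟩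
  have hfirst : Satisfies (L (firstTests σ)) (w false false, w true false) :=
    satisfies_syntacticMonoid_passing fun _ _ _ =>
      ⟨fun h => firstTests_passes_congr h _, fun h => firstTests_passes_congr h _⟩
  have hboth : Satisfies (L (lastTests σ ∪ firstTests σ)) (w false true, w true false) :=
    satisfies_syntacticMonoid_passing fun _ _ _ =>
      ⟨fun h => lastTests_union_firstTests_passes_congr h (.inr rfl) _ _,
        fun h => lastTests_union_firstTests_passes_congr h (.inl rfl) _ _⟩
  exact not_isDistributive_of_not_satisfies syntacticMonoid_passing_mem
    syntacticMonoid_passing_mem hlast hfirst hboth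
    (fun _ => satisfies_syntacticMonoid_passing_union)
    fun h => identityWord_notMem_passing (h.mem_iff_mem.mp identityWord_mem_passing)
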